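/- Let $K$ be a field of characteristic zero and let $\mathcal D$ be a finite set. Let $\mathrm{Br}(\mathcal D)$ be the free brace algebra over $K$ generated by $\mathcal D$. It has as a basis the set of planar rooted trees decorated by $\mathcal D$ (write $B_d(t_1\cdots t_n)$ for the tree whose root is decorated by $d\in\mathcal D$ and carries the subtrees $t_1,\dots,t_n$ in this order from left to right), and $\langle t_1,\dots,t_{n};t\rangle$ is the sum of all graftings of the planar forest $t_1\cdots t_{n}$ over the planar tree $t$. Consider $\mathrm{Br}(\mathcal D)$ only with the product $\langle -;-\rangle$, given on trees by $$\langle t;B_d(t_1\cdots t_n)\rangle=\sum_{i=0}^nB_d(t_1\cdots t_i\,t\,t_{i+1}\cdots t_n)+\sum_{i=1}^nB_d(t_1\cdots t_{i-1}\langle t;t_i\rangle t_{i+1}\cdots t_n),$$ which makes it a (left) pre-Lie algebra, i.e. with $x\circ y=\langle x;y\rangle$ one has $(x\circ y)\circ z-x\circ(y\circ z)=(y\circ x)\circ z-y\circ(x\circ z)$. Then $\mathrm{Br}(\mathcal D)$ is a free pre-Lie algebra. More precisely, let $\star$ be the bilinear product on $\mathrm{Br}(\mathcal D)$ with $$t\star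 B_d(t_1\cdots t_n)=\sum_{i=0}^nB_d(t_1\cdots t_i\,t\,t_{i+1}\cdots t_n)$$ for trees $t,t_1,\dots,t_n$ and $d\in\mathcal D$, let $\mathrm{Br}(\mathcal D)\star\mathrm{Br}(\mathcal D)$ be the subspace spanned by all the elements $x\star y$, and give $\mathrm{Br}(\mathcal D)$ the $\mathbb N^2$-grading in which $\mathrm{Br}(\mathcal D)(k,l)$ is spanned by the trees with $k$ vertices whose root has exactly $l$ children. Then $\mathrm{Br}(\mathcal D)\star\mathrm{Br}(\mathcal D)$ has an $\mathbb N^2$-graded complement in $\mathrm{Br}(\mathcal D)$, and for every $\mathbb N^2$-graded complement $V$, every basis $(v_i)_{i\in I}$ of $V$ generates $(\mathrm{Br}(\mathcal D),\langle -;-\rangle)$ freely as a pre-Lie algebra: for every pre-Lie algebra $P$ over $K$ and every map $f:I\to P$ there is a unique morphism of pre-Lie algebras $\varphi:\mathrm{Br}(\mathcal D)\to P$ with $\varphi(v_i)=f(i)$ for all $i\in I$. -/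

import Mathlib

universe u v w x

/-! ### Brace algebras and pre-Lie algebras -/

/-- All the ways of cutting a finite sequence into two (possibly empty) consecutive pieces. -/
def splits {α : Type u} : List α → List (List α × List α)
  | [] => [([], [])]
  | a :: l => ([], a :: l) :: (splits l).map fun p => (a :: p.1, p.2)

/-- For `as = (a₁, …, aₘ)` and `bs = (b₁, …, bₙ)`, the family of all the sequences
`A₀, ⟨A₁; b₁⟩, A₂, ⟨A₃; b₂⟩, A₄, …, ⟨A₂ₙ₋₁; bₙ⟩, A₂ₙ`, where `as = A₀ A₁ ⋯ A₂ₙ` runs over the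
partitions of `as` into `2n + 1` (possibly empty) consecutive intervals. -/
def braceExpand {A : Type u} (br : List A → A → A) : List A → List A → Multiset (List A)
  | as, [] => {as}
  | as, b :: bs =>
    (splits as : Multiset (List A × List A)).bind fun p =>
      (splits p.2 : Multiset (List A × List A)).bind fun q =>
        (braceExpand br q.2 bs).map fun l => p.1 ++ br q.1 b :: l

/-- A brace algebra: a vector space with multilinear operations
`brace [a₁, …, aₘ] c = ⟨a₁, …, aₘ; c⟩`, with the convention `⟨c⟩ = c`, such that
`⟨a₁, …, aₘ; ⟨b₁, …, bₙ; c⟩⟩ = ∑ ⟨A₀, ⟨A₁; b₁⟩, A₂, …, ⟨A₂ₙ₋₁; bₙ⟩, A₂ₙ; c⟩`. -/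
class BraceAlgebra (K : Type u) (A : Type v) [Field K] [AddCommGroup A] [Module K A] where
  brace : List A → A → A
  brace_nil : ∀ c, brace [] c = c
  brace_add_left : ∀ l a a' r c,
    brace (l ++ (a + a') :: r) c = brace (l ++ a :: r) c + brace (l ++ a' :: r) c
  brace_smul_left : ∀ (k : K) l a r c, brace (l ++ (k • a) :: r) c = k • brace (l ++ a :: r) c
  brace_add_right : ∀ l c c', brace l (c + c') = brace l c + brace l c'
  brace_smul_right : ∀ (k : K) l c, brace l (k • c) = k • brace l c
  brace_brace : ∀ as bs c,
    brace as (brace bs c) = ((braceExpand brace as bs).map fun l => brace l c).sum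

/-- `A` is a free brace algebra over `K`, freely generated by the family `ι`. -/
def IsFreeBraceAlgebra (K : Type u) {I : Type v} {A : Type w} [Field K] [AddCommGroup A]
    [Module K A] [BraceAlgebra K A] (ι : I → A) : Prop :=
  ∀ (B : Type x) [AddCommGroup B] [Module K B] [BraceAlgebra K B] (f : I → B),
    ∃! φ : A →ₗ[K] B,
      (∀ as c, φ (BraceAlgebra.brace K as c) = BraceAlgebra.brace K (as.map φ) (φ c)) ∧
        ∀ i, φ (ι i) = f i

/-- `A` is a free (left) pre-Lie algebra over `K`, freely generated by the family `ι`. -/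
def IsFreePreLieAlgebra (K : Type u) {I : Type v} {A : Type w} [Field K] [LeftPreLieRing A]
    [LeftPreLieAlgebra K A] (ι : I → A) : Prop :=
  ∀ (P : Type x) [LeftPreLieRing P] [LeftPreLieAlgebra K P] (f : I → P),
    ∃! φ : A →ₙₐ[K] P, ∀ i, φ (ι i) = f i

/-- The pre-Lie product `⟨a; b⟩` of a brace algebra. -/
abbrev BraceAlgebra.toLeftPreLieRing (K : Type u) (A : Type v) [Field K] [AddCommGroup A]
    [Module K A] [BraceAlgebra K A] : LeftPreLieRing A where
  mul a b := BraceAlgebra.brace K [a] b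
  left_distrib a b c := BraceAlgebra.brace_add_right [a] b c
  right_distrib a b c := BraceAlgebra.brace_add_left [] a b [] c
  zero_mul a := by
    have h := BraceAlgebra.brace_smul_left (0 : K) [] (0 : A) [] a
    simp only [zero_smul] at h
    exact h
  mul_zero a := by
    have h := BraceAlgebra.brace_smul_right (0 : K) [a] (0 : A)
    simp only [zero_smul] at h
    exact h
  assoc_symm' a b c := by
    change BraceAlgebra.brace K [BraceAlgebra.brace K [a] b] c
        - BraceAlgebra.brace K [a] (BraceAlgebra.brace K [b] c)
      = BraceAlgebra.brace K [BraceAlgebra.brace K [b] a] c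
        - BraceAlgebra.brace K [b] (BraceAlgebra.brace K [a] c)
    rw [BraceAlgebra.brace_brace, BraceAlgebra.brace_brace]
    simp [braceExpand, splits, BraceAlgebra.brace_nil]
    abel

/-! ### Planar rooted trees -/

/-- Planar rooted trees decorated by `D`: `node d [t₁, …, tₙ]` is `B_d(t₁ ⋯ tₙ)`. -/
inductive PlanarTree (D : Type u) : Type u
  | node : D → List (PlanarTree D) → PlanarTree D

namespace PlanarTree

/-- The number of vertices. -/
def weight {D : Type u} : PlanarTree D → ℕ
  | node _ ts => 1 + (ts.map weight).sum

/-- The fertility of the root. -/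
def rootFertility {D : Type u} : PlanarTree D → ℕ
  | node _ ts => ts.length

/-- All the graftings of the planar forest `F` over the planar forest `G`, with multiplicity:
consecutive pieces of `F` are inserted between the trees of `G` or grafted over these trees. -/
def graftForest {D : Type u} :
    List (PlanarTree D) → List (PlanarTree D) → Multiset (List (PlanarTree D))
  | F, [] => {F}
  | F, node d ts :: G =>
    (splits F : Multiset (List (PlanarTree D) × List (PlanarTree D))).bind fun p =>
      (splits p.2 : Multiset (List (PlanarTree D) × List (PlanarTree D))).bind fun q =>
        (graftForest q.1 ts).bind fun us =>
          (graftForest q.2 G).map fun H => p.1 ++ node d us :: H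

/-- All the graftings of the planar forest `F` over the planar tree `t`, with multiplicity. -/
def graft {D : Type u} (F : List (PlanarTree D)) : PlanarTree D → Multiset (PlanarTree D)
  | node d ts => (graftForest F ts).map (node d)

/-- All the graftings of the planar tree `t` on the root of a planar tree: for
`B_d(t₁ ⋯ tₙ)`, these are the trees `B_d(t₁ ⋯ tᵢ t tᵢ₊₁ ⋯ tₙ)`, `0 ≤ i ≤ n`. -/
def rootGraft {D : Type u} (t : PlanarTree D) : PlanarTree D → Multiset (PlanarTree D)
  | node d ts => ((splits ts).map fun p => node d (p.1 ++ t :: p.2) : List (PlanarTree D))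

end PlanarTree

/-! ### Sums over families -/

section

variable {α : Type u} {β : Type v} {M : Type w} [AddCommMonoid M]

/-- The sum of a function over a finite family. -/
def msum (s : Multiset α) (f : α → M) : M := (s.map f).sum

/-- The sum of a function over the ways of cutting a finite sequence into two pieces. -/
def ssum (l : List α) (f : List α → List α → M) : M :=
  msum (splits l : Multiset (List α × List α)) fun p => f p.1 p.2

theorem msum_add (s : Multiset α) (f g : α → M) :
    (msum s fun a => f a + g a) = msum s f + msum s g := Multiset.sum_map_add

theorem ssum_add (l : List α) (f g : List α → List α → M) :
    (ssum l fun x y => f x y + g x y) = ssum l f + ssum l g :=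
  msum_add (splits l : Multiset (List α × List α)) (fun p => f p.1 p.2) fun p => g p.1 p.2

theorem msum_zero_family (f : α → M) : msum 0 f = 0 := rfl

theorem msum_add_family (s t : Multiset α) (f : α → M) :
    msum (s + t) f = msum s f + msum t f := by simp [msum]

theorem msum_singleton (a : α) (f : α → M) : msum {a} f = f a := by simp [msum]

theorem msum_map (s : Multiset β) (g : β → α) (f : α → M) :
    msum (s.map g) f = msum s fun b => f (g b) := by simp [msum]

theorem msum_bind (s : Multiset β) (g : β → Multiset α) (f : α → M) :
    msum (s.bind g) f = msum s fun b => msum (g b) f := by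
  simp [msum, Multiset.map_bind, Multiset.sum_bind]

theorem msum_hom {N : Type x} [AddCommMonoid N] {F : Type*} [FunLike F M N]
    [AddMonoidHomClass F M N] (φ : F) (s : Multiset α) (f : α → M) :
    φ (msum s f) = msum s fun a => φ (f a) := by
  simp [msum, map_multiset_sum, Multiset.map_map]

theorem msum_comm (s : Multiset α) (t : Multiset β) (f : α → β → M) :
    (msum s fun a => msum t fun b => f a b) = msum t fun b => msum s fun a => f a b :=
  Multiset.sum_map_sum_map s t

theorem msum_ssum (s : Multiset α) (l : List β) (f : α → List β → List β → M) :
    (msum s fun a => ssum l fun x y => f a x y) = ssum l fun x y => msum s fun a => f a x y :=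
  msum_comm _ _ _

theorem ssum_comm (k : List α) (l : List β) (f : List α → List α → List β → List β → M) :
    (ssum k fun u v => ssum l fun x y => f u v x y) =
      ssum l fun x y => ssum k fun u v => f u v x y :=
  msum_comm _ _ _

theorem ssum_nil (f : List α → List α → M) : ssum [] f = f [] [] := by
  simp [ssum, msum, splits]

theorem ssum_cons (a : α) (l : List α) (f : List α → List α → M) :
    ssum (a :: l) f = f [] (a :: l) + ssum l fun x y => f (a :: x) y := by
  simp [ssum, msum, splits, Function.comp_def]

theorem ssum_append_cons (l : List α) (a : α) (r : List α) (f : List α → List α → M) :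
    ssum (l ++ a :: r) f = (ssum l fun x y => f x (y ++ a :: r)) +
      ssum r fun x y => f (l ++ a :: x) y := by
  induction l generalizing f with
  | nil => simp [ssum_cons, ssum_nil]
  | cons b l ih => simp [ssum_cons, ih, add_assoc]

theorem ssum_map (e : β → α) (l : List β) (f : List α → List α → M) :
    ssum (l.map e) f = ssum l fun x y => f (x.map e) (y.map e) := by
  induction l generalizing f with
  | nil => simp [ssum_nil]
  | cons b l ih => simp [ssum_cons, ih]

theorem ssum_ssum (l : List α) (f : List α → List α → List α → M) :
    (ssum l fun p z => ssum p fun x y => f x y z) =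
      ssum l fun x p => ssum p fun y z => f x y z := by
  induction l generalizing f with
  | nil => rfl
  | cons a l ih =>
    simp only [ssum_cons, ssum_add, ssum_nil, ih (fun x y z => f (a :: x) y z), add_assoc]

end

section

variable {K : Type u} {A : Type v} {M : Type w} [Field K] [AddCommGroup M] [Module K M]

theorem smul_msum {α : Type x} (k : K) (s : Multiset α) (f : α → M) :
    k • msum s f = msum s fun a => k • f a := by
  simp [msum, Multiset.smul_sum]

theorem smul_ssum {α : Type x} (k : K) (l : List α) (f : List α → List α → M) :
    k • ssum l f = ssum l fun x y => k • f x y := smul_msum _ _ _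

theorem msum_braceExpand_nil (br : List A → A → A) (as : List A) (h : List A → M) :
    msum (braceExpand br as []) h = h as := by
  simp [braceExpand, msum]

theorem msum_braceExpand_cons (br : List A → A → A) (as : List A) (b : A) (bs : List A)
    (h : List A → M) :
    msum (braceExpand br as (b :: bs)) h =
      ssum as fun x r => ssum r fun y z =>
        msum (braceExpand br z bs) fun l => h (x ++ br y b :: l) := by
  simp only [braceExpand, msum_bind, msum_map, ssum]

end

/-! ### Multilinear functions of a finite sequence of vectors -/

/-- A function on finite sequences of vectors that is linear in each entry. -/
structure IsSeqLinear (K : Type u) {A : Type v} {M : Type w} [Field K] [AddCommGroup A] [Module K A]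
    [AddCommGroup M] [Module K M] (f : List A → M) : Prop where
  add : ∀ l a a' r, f (l ++ (a + a') :: r) = f (l ++ a :: r) + f (l ++ a' :: r)
  smul : ∀ (k : K) l a r, f (l ++ (k • a) :: r) = k • f (l ++ a :: r)

namespace IsSeqLinear

variable {K : Type u} {A : Type v} {M : Type w} {N : Type x} [Field K] [AddCommGroup A] [Module K A]
  [AddCommGroup M] [Module K M] [AddCommGroup N] [Module K N]

theorem shift {f : List A → M} (hf : IsSeqLinear K f) (p : List A) :
    IsSeqLinear K fun l => f (p ++ l) :=
  ⟨fun l a a' r => by simpa using hf.add (p ++ l) a a' r,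
    fun k l a r => by simpa using hf.smul k (p ++ l) a r⟩

theorem shift_right {f : List A → M} (hf : IsSeqLinear K f) (q : List A) :
    IsSeqLinear K fun l => f (l ++ q) :=
  ⟨fun l a a' r => by simpa using hf.add l a a' (r ++ q),
    fun k l a r => by simpa using hf.smul k l a (r ++ q)⟩

theorem comp {f : List A → M} (hf : IsSeqLinear K f) (φ : M →ₗ[K] N) :
    IsSeqLinear K fun l => φ (f l) :=
  ⟨fun l a a' r => by simp [hf.add], fun k l a r => by simp [hf.smul]⟩

/-- The linear function given by one entry. -/
def entry {f : List A → M} (hf : IsSeqLinear K f) (p q : List A) : A →ₗ[K] M where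
  toFun a := f (p ++ a :: q)
  map_add' a a' := hf.add p a a' q
  map_smul' k a := hf.smul k p a q

theorem msum {β : Type*} (s : Multiset β) {f : β → List A → M} (hf : ∀ b, IsSeqLinear K (f b)) :
    IsSeqLinear K fun l => _root_.msum s fun b => f b l :=
  ⟨fun l a a' r => by simp [(hf _).add, msum_add],
    fun k l a r => by simp [(hf _).smul, smul_msum]⟩

theorem ssum {g : List A → List A → M} (h₁ : ∀ y, IsSeqLinear K fun l => g l y)
    (h₂ : ∀ l, IsSeqLinear K (g l)) : IsSeqLinear K fun l => _root_.ssum l g := by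
  constructor
  · intro l a a' r
    simp only [ssum_append_cons, (h₂ _).add, (h₁ _).add, ssum_add]
    abel
  · intro k l a r
    simp only [ssum_append_cons, (h₂ _).smul, (h₁ _).smul, smul_ssum, smul_add]

theorem braceExpand_left {br : List A → A → A} (hbr : ∀ b, IsSeqLinear K fun l => br l b)
    (bs : List A) :
    ∀ {h : List A → M}, IsSeqLinear K h →
      IsSeqLinear K fun as => _root_.msum (braceExpand br as bs) h := by
  induction bs with
  | nil => intro h hh; simpa only [msum_braceExpand_nil] using hh
  | cons b bs ih =>
    intro h hh
    simp only [msum_braceExpand_cons]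
    refine IsSeqLinear.ssum (fun r => ?_) fun x => IsSeqLinear.ssum (fun z => ?_) fun y => ?_
    · exact IsSeqLinear.msum (splits r : Multiset (List A × List A))
        fun q => IsSeqLinear.msum _ fun l => hh.shift_right _
    · exact IsSeqLinear.msum _ fun l => (hbr b).comp (hh.entry x l)
    · refine ih (h := fun l => h (x ++ br y b :: l)) ?_
      simpa using hh.shift (x ++ [br y b])

theorem braceExpand_right {br : List A → A → A}
    (hadd : ∀ l c c', br l (c + c') = br l c + br l c')
    (hsmul : ∀ (k : K) l c, br l (k • c) = k • br l c) (as : List A)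
    {h : List A → M} (hh : IsSeqLinear K h) :
    IsSeqLinear K fun bs => _root_.msum (braceExpand br as bs) h := by
  constructor
  · intro l a a' r
    induction l generalizing as h with
    | nil =>
      simp only [List.nil_append, msum_braceExpand_cons, hadd, hh.add, msum_add, ssum_add]
    | cons c l ih =>
      simp only [List.cons_append, msum_braceExpand_cons, ← ssum_add]
      congr! 6 with x r y z
      exact ih z (h := fun l => h (x ++ br y c :: l)) (by simpa using hh.shift (x ++ [br y c]))
  · intro k l a r
    induction l generalizing as h with
    | nil =>
      simp only [List.nil_append, msum_braceExpand_cons, hsmul, hh.smul, smul_msum, smul_ssum]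
    | cons c l ih =>
      simp only [List.cons_append, msum_braceExpand_cons, smul_ssum]
      congr! 6 with x r y z
      exact ih z (h := fun l => h (x ++ br y c :: l)) (by simpa using hh.shift (x ++ [br y c]))

end IsSeqLinear

namespace PlanarTree

/-! ### Associativity of graftings -/

section

variable {D : Type u} {M : Type v} [AddCommMonoid M]

theorem msum_graftForest_nil (F : List (PlanarTree D)) (h : List (PlanarTree D) → M) :
    msum (graftForest F []) h = h F := by
  simp [graftForest, msum]

theorem msum_graft (F : List (PlanarTree D)) (d : D) (G : List (PlanarTree D))
    (h : PlanarTree D → M) :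
    msum (graft F (node d G)) h = msum (graftForest F G) fun H => h (node d H) := by
  simp [graft, msum]

theorem msum_graftForest_cons (F : List (PlanarTree D))
    (t : PlanarTree D) (G : List (PlanarTree D)) (h : List (PlanarTree D) → M) :
    msum (graftForest F (t :: G)) h =
      ssum F fun x r => ssum r fun y z => msum (graft y t) fun u =>
        msum (graftForest z G) fun H => h (x ++ u :: H) := by
  obtain ⟨d, ts⟩ := t
  simp only [graftForest, graft, msum_bind, msum_map, ssum]

theorem ssum_graftForest (F G : List (PlanarTree D))
    (h : List (PlanarTree D) → List (PlanarTree D) → M) :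
    (msum (graftForest F G) fun H => ssum H h) =
      ssum F fun x y => ssum G fun u v =>
        msum (graftForest x u) fun H => msum (graftForest y v) fun H' => h H H' := by
  induction G generalizing F h with
  | nil => simp [msum_graftForest_nil, ssum_nil]
  | cons t G ih =>
    simp only [msum_graftForest_cons, ssum_append_cons, msum_add, ssum_add, ssum_cons,
      msum_graftForest_nil]
    congr 1
    · simp only [msum_ssum]
      refine Eq.trans ?_ (ssum_ssum _ _)
      exact congrArg (ssum F) (funext₂ fun x r => ssum_comm _ _ _)
    · simp only [ih, msum_ssum]
      symm
      refine (congrArg (ssum F) (funext₂ fun p q => ssum_comm _ _ _)).trans ?_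
      refine (ssum_ssum _ _).trans (congrArg (ssum F) (funext₂ fun x r => ?_))
      refine (congrArg (ssum r) (funext₂ fun p q => ssum_comm _ _ _)).trans ?_
      exact ssum_ssum r _

theorem msum_graftForest_append_cons (F u : List (PlanarTree D))
    (t : PlanarTree D) (G : List (PlanarTree D)) (h : List (PlanarTree D) → M) :
    msum (graftForest F (u ++ t :: G)) h =
      ssum F fun x r => ssum r fun y z => msum (graftForest x u) fun X =>
        msum (graft y t) fun s => msum (graftForest z G) fun H => h (X ++ s :: H) := by
  induction u generalizing F h with
  | nil => simp [msum_graftForest_nil, msum_graftForest_cons]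
  | cons c u ih =>
    simp only [List.cons_append, msum_graftForest_cons, ih, msum_ssum, List.append_assoc, List.cons_append]
    symm
    refine (congrArg (ssum F) (funext₂ fun p q => ssum_comm _ _ _)).trans ?_
    refine (ssum_ssum _ _).trans (congrArg (ssum F) (funext₂ fun x r => ?_))
    refine (congrArg (ssum r) (funext₂ fun p q => ssum_comm _ _ _)).trans ?_
    exact ssum_ssum r _

theorem graftForest_assoc : ∀ (C A B : List (PlanarTree D)) (h : List (PlanarTree D) → M),
    (msum (graftForest B C) fun X => msum (graftForest A X) h) =
      msum (graftForest A B) fun X => msum (graftForest X C) h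
  | [], A, B, h => by simp only [msum_graftForest_nil]
  | node d ts :: G, A, B, h => by
    have ih₁ := graftForest_assoc ts
    have ih₂ := graftForest_assoc G
    simp only [msum_graftForest_cons, msum_graftForest_append_cons, msum_graft, ssum_graftForest,
      msum_ssum]
    refine (congrArg (ssum B) (funext₂ fun u v => ssum_comm _ _ _)).trans ?_
    refine (ssum_comm _ _ _).trans (congrArg (ssum A) (funext₂ fun x r => ?_))
    refine congrArg (ssum B) (funext₂ fun u v => (ssum_comm _ _ _).trans ?_)
    refine congrArg (ssum r) (funext₂ fun y z => congrArg (ssum v) (funext₂ fun b c => ?_))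
    have key : ∀ X, (msum (graftForest b ts) fun H => msum (graftForest c G) fun a =>
        msum (graftForest y H) fun H' => msum (graftForest z a) fun a' =>
          h (X ++ node d H' :: a')) =
        msum (graftForest y b) fun H => msum (graftForest z c) fun a =>
          msum (graftForest H ts) fun H' => msum (graftForest a G) fun a' =>
            h (X ++ node d H' :: a') := by
      intro X
      calc _ = msum (graftForest b ts) fun H => msum (graftForest y H) fun H' =>
            msum (graftForest c G) fun a => msum (graftForest z a) fun a' =>
              h (X ++ node d H' :: a') :=
            congrArg (msum _) (funext fun H => msum_comm _ _ _)
        _ = msum (graftForest y b) fun H => msum (graftForest H ts) fun H' =>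
            msum (graftForest z c) fun a => msum (graftForest a G) fun a' =>
              h (X ++ node d H' :: a') := by
            simp only [ih₂]
            exact ih₁ _ _ _
        _ = _ := congrArg (msum _) (funext fun H => msum_comm _ _ _)
    rw [← funext key]
    refine (congrArg (msum _) (funext fun H => msum_comm _ _ _)).trans ?_
    exact msum_comm _ _ _

theorem graftForest_nil_left : ∀ G : List (PlanarTree D), graftForest [] G = {G}
  | [] => by simp [graftForest]
  | node d ts :: G => by
    simp [graftForest, splits, graftForest_nil_left ts, graftForest_nil_left G]

end

end PlanarTree

/-! ### The free brace algebra -/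

/-- The vector space with basis the planar rooted trees decorated by `D`, which carries the free
brace algebra generated by `D`. -/
def Br (K : Type u) (D : Type v) [Field K] : Type (max u v) := PlanarTree D →₀ K

namespace Br

variable {K : Type u} {D : Type v} [Field K]

noncomputable instance : AddCommGroup (Br K D) := inferInstanceAs (AddCommGroup (PlanarTree D →₀ K))

noncomputable instance : Module K (Br K D) := inferInstanceAs (Module K (PlanarTree D →₀ K))

/-- A planar tree as an element of the space `Br K D`. -/
noncomputable def of (K : Type u) {D : Type v} [Field K] (t : PlanarTree D) : Br K D :=
  Finsupp.single t 1

/-- The linear map with prescribed values on planar trees. -/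
noncomputable def lin (K : Type u) {D : Type v} {M : Type w} [Field K] [AddCommGroup M] [Module K M]
    (f : PlanarTree D → M) : Br K D →ₗ[K] M :=
  Finsupp.linearCombination K f

/-- The function on sequences, linear in each entry, with prescribed values on planar forests. -/
noncomputable def multilin (K : Type u) {D : Type v} {M : Type w} [Field K] [AddCommGroup M]
    [Module K M] : (List (PlanarTree D) → M) → List (Br K D) → M
  | g, [] => g []
  | g, a :: as => lin K (fun t => multilin K (fun F => g (t :: F)) as) a

/-- The brace operations: for planar trees, `⟨t₁, …, tₙ; t⟩` is the sum of the graftings of the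
planar forest `t₁ ⋯ tₙ` over `t`. -/
noncomputable def brace (as : List (Br K D)) (c : Br K D) : Br K D :=
  lin K (fun t => multilin K (fun F => ((PlanarTree.graft F t).map (of K)).sum) as) c

section

variable {M : Type w} [AddCommGroup M] [Module K M]

theorem lin_of (f : PlanarTree D → M) (t : PlanarTree D) : lin K f (of K t) = f t := by
  refine (Finsupp.linearCombination_single K (1 : K) t).trans ?_
  simp

theorem induction_on {p : Br K D → Prop} (a : Br K D) (zero : p 0)
    (add : ∀ a b, p a → p b → p (a + b)) (smul : ∀ (k : K) t, p (k • of K t)) : p a := by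
  refine Finsupp.induction_linear (motive := p) a zero add fun t k => ?_
  have h : k • of K t = (Finsupp.single t k : PlanarTree D →₀ K) := by
    change k • (Finsupp.single t 1 : PlanarTree D →₀ K) = _
    simp
  exact h ▸ smul k t

theorem hom_ext {f g : Br K D →ₗ[K] M} (h : ∀ t, f (of K t) = g (of K t)) : f = g := by
  ext a
  induction a using induction_on with
  | zero => simp
  | add a b ha hb => simp [ha, hb]
  | smul k t => simp [h]

theorem multilin_of (g : List (PlanarTree D) → M) (F : List (PlanarTree D)) :
    multilin K g (F.map (of K)) = g F := by
  induction F generalizing g with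
  | nil => rfl
  | cons t F ih => simp [multilin, lin_of, ih]

theorem isSeqLinear_multilin (g : List (PlanarTree D) → M) : IsSeqLinear K (multilin K g) := by
  constructor
  · intro l a a' r
    induction l generalizing g with
    | nil => simp [multilin]
    | cons b l ih =>
      simp only [List.cons_append, multilin, ih]
      rw [← LinearMap.add_apply]
      congr 1
      exact hom_ext fun t => by simp [lin_of]
  · intro k l a r
    induction l generalizing g with
    | nil => simp [multilin]
    | cons b l ih =>
      simp only [List.cons_append, multilin, ih]
      rw [← LinearMap.smul_apply]
      congr 1
      exact hom_ext fun t => by simp [lin_of]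

theorem seqLinear_ext {f g : List (Br K D) → M} (hf : IsSeqLinear K f) (hg : IsSeqLinear K g)
    (h : ∀ F : List (PlanarTree D), f (F.map (of K)) = g (F.map (of K))) (as : List (Br K D)) :
    f as = g as := by
  suffices H : ∀ (as : List (Br K D)) (F : List (PlanarTree D)),
      f (F.map (of K) ++ as) = g (F.map (of K) ++ as) from H as []
  intro as
  induction as with
  | nil => simpa using h
  | cons a as ih =>
    intro F
    have key : hf.entry (F.map (of K)) as = hg.entry (F.map (of K)) as :=
      hom_ext fun t => by simpa [IsSeqLinear.entry] using ih (F ++ [t])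
    exact LinearMap.congr_fun key a

end

theorem isSeqLinear_brace (c : Br K D) : IsSeqLinear K fun as => brace as c := by
  constructor
  · intro l a a' r
    simp only [brace, (isSeqLinear_multilin _).add]
    rw [← LinearMap.add_apply]
    congr 1
    exact hom_ext fun t => by simp [lin_of]
  · intro k l a r
    simp only [brace, (isSeqLinear_multilin _).smul]
    rw [← LinearMap.smul_apply]
    congr 1
    exact hom_ext fun t => by simp [lin_of]

theorem brace_of (F : List (PlanarTree D)) (t : PlanarTree D) :
    brace (F.map (of K)) (of K t) = msum (PlanarTree.graft F t) (of K) := by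
  simp [brace, lin_of, multilin_of, msum]

theorem brace_add (as : List (Br K D)) (c c' : Br K D) :
    brace as (c + c') = brace as c + brace as c' := map_add _ _ _

theorem brace_smul (k : K) (as : List (Br K D)) (c : Br K D) :
    brace as (k • c) = k • brace as c := map_smul _ _ _

/-- The brace operations as linear maps in the last variable. -/
noncomputable def braceLin (as : List (Br K D)) : Br K D →ₗ[K] Br K D where
  toFun := brace as
  map_add' := brace_add as
  map_smul' k c := brace_smul k as c

/-- The comparison between graftings of planar forests and the expansion in a brace algebra. -/
theorem msum_graftForest_eq {A : Type w} {M : Type x} [AddCommGroup A] [Module K A]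
    [AddCommGroup M] [Module K M] {br : List A → A → A} {e : PlanarTree D → A}
    (G : List (PlanarTree D))
    (he : ∀ t ∈ G, ∀ F, msum (PlanarTree.graft F t) e = br (F.map e) (e t))
    (F : List (PlanarTree D)) {h : List A → M} (hh : IsSeqLinear K h) :
    (msum (PlanarTree.graftForest F G) fun H => h (H.map e)) =
      msum (braceExpand br (F.map e) (G.map e)) h := by
  induction G generalizing F h with
  | nil => simp [PlanarTree.msum_graftForest_nil, msum_braceExpand_nil]
  | cons t G ih =>
    simp only [PlanarTree.msum_graftForest_cons, List.map_cons, msum_braceExpand_cons, ssum_map]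
    refine congrArg (ssum F) (funext₂ fun x r => congrArg (ssum r) (funext₂ fun y z => ?_))
    rw [← he t (by simp)]
    have key : ∀ u, (msum (PlanarTree.graftForest z G) fun H => h ((x ++ u :: H).map e)) =
        msum (braceExpand br (z.map e) (G.map e)) fun l => hh.entry (x.map e) l (e u) := by
      intro u
      have := ih (fun t ht => he t (by simp [ht])) z (h := fun l => h (x.map e ++ e u :: l))
        (by simpa using hh.shift (x.map e ++ [e u]))
      simpa [IsSeqLinear.entry] using this
    simp only [key]
    rw [msum_comm]
    refine congrArg (msum _) (funext fun l => ?_)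
    exact (msum_hom (hh.entry (x.map e) l) _ e).symm

theorem brace_brace_of (F G : List (PlanarTree D)) (t : PlanarTree D) :
    brace (F.map (of K)) (brace (G.map (of K)) (of K t)) =
      msum (braceExpand brace (F.map (of K)) (G.map (of K))) fun l => brace l (of K t) := by
  rw [← msum_graftForest_eq G (fun t _ F => (brace_of F t).symm) F (isSeqLinear_brace (of K t)),
    brace_of]
  refine (msum_hom (braceLin (F.map (of K))) _ (of K)).trans ?_
  obtain ⟨d, C⟩ := t
  simp only [braceLin, LinearMap.coe_mk, AddHom.coe_mk, brace_of, PlanarTree.msum_graft,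
    ← PlanarTree.graftForest_assoc]

theorem brace_brace (as bs : List (Br K D)) (c : Br K D) :
    brace as (brace bs c) = msum (braceExpand brace as bs) fun l => brace l c := by
  induction c using induction_on with
  | zero =>
    have h : ∀ l : List (Br K D), brace l (0 : Br K D) = 0 := fun l => map_zero (braceLin l)
    simp [h, msum]
  | add c c' hc hc' => simp only [brace_add, msum_add, hc, hc']
  | smul k t =>
    simp only [brace_smul, ← smul_msum]
    congr 1
    refine seqLinear_ext (isSeqLinear_brace _)
      (IsSeqLinear.braceExpand_left isSeqLinear_brace bs (isSeqLinear_brace _)) (fun F => ?_) as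
    refine seqLinear_ext ((isSeqLinear_brace (of K t)).comp (braceLin (F.map (of K))))
      (IsSeqLinear.braceExpand_right brace_add brace_smul _ (isSeqLinear_brace _)) (fun G => ?_) bs
    exact brace_brace_of F G t

noncomputable instance : BraceAlgebra K (Br K D) where
  brace := brace
  brace_nil c := by
    refine LinearMap.congr_fun (f := lin K _) (g := LinearMap.id) (hom_ext fun t => ?_) c
    obtain ⟨d, ts⟩ := t
    simp [lin_of, multilin, PlanarTree.graft, PlanarTree.graftForest_nil_left]
  brace_add_left l a a' r c := (isSeqLinear_brace c).add l a a' r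
  brace_smul_left k l a r c := (isSeqLinear_brace c).smul k l a r
  brace_add_right := brace_add
  brace_smul_right := brace_smul
  brace_brace as bs c := brace_brace as bs c

noncomputable instance : LeftPreLieRing (Br K D) := BraceAlgebra.toLeftPreLieRing K (Br K D)

noncomputable instance : LeftPreLieAlgebra K (Br K D) where
  smul_assoc k a b := BraceAlgebra.brace_smul_left k [] a [] b
  smul_comm k a b := (BraceAlgebra.brace_smul_right k [a] b).symm

/-- The pre-Lie product of two planar trees `t`, `t'` is the sum of the graftings of `t` over
`t'`. -/
theorem of_mul_of (t t' : PlanarTree D) :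
    of K t * of K t' = ((PlanarTree.graft [t] t').map (of K)).sum :=
  brace_of [t] t'

/-! ### The universal property -/

section

variable {B : Type x} [AddCommGroup B] [Module K B] [BraceAlgebra K B]

/-- The values on planar trees of the morphism of brace algebras extending `f`. -/
def extend (K : Type u) {D : Type v} {B : Type x} [Field K] [AddCommGroup B] [Module K B]
    [BraceAlgebra K B] (f : D → B) : PlanarTree D → B
  | .node d ts => BraceAlgebra.brace K (ts.map (extend K f)) (f d)

theorem isSeqLinear_braceAlgebra (c : B) :
    IsSeqLinear K fun as : List B => BraceAlgebra.brace K as c :=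
  ⟨fun l a a' r => BraceAlgebra.brace_add_left l a a' r c,
    fun k l a r => BraceAlgebra.brace_smul_left k l a r c⟩

theorem msum_graft_extend (f : D → B) : ∀ (F : List (PlanarTree D)) (t : PlanarTree D),
    msum (PlanarTree.graft F t) (extend K f) =
      BraceAlgebra.brace K (F.map (extend K f)) (extend K f t)
  | F, .node d ts => by
    have he : ∀ t ∈ ts, ∀ F, msum (PlanarTree.graft F t) (extend K f) =
        BraceAlgebra.brace K (F.map (extend K f)) (extend K f t) :=
      fun t _ F => msum_graft_extend f F t
    have key := msum_graftForest_eq (K := K) ts he F (isSeqLinear_braceAlgebra (f d))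
    simp only [PlanarTree.msum_graft, extend, BraceAlgebra.brace_brace]
    exact key
termination_by _ t => t

theorem brace_root (d : D) (ts : List (PlanarTree D)) :
    BraceAlgebra.brace K (ts.map (of K)) (of K (.node d [])) = of K (.node d ts) := by
  refine (brace_of ts (.node d [])).trans ?_
  simp [PlanarTree.msum_graft, PlanarTree.msum_graftForest_nil]

theorem eq_extend {f : D → B} {ψ : Br K D →ₗ[K] B}
    (h : ∀ as c, ψ (BraceAlgebra.brace K as c) = BraceAlgebra.brace K (as.map ψ) (ψ c))
    (h' : ∀ d, ψ (of K (.node d [])) = f d) : ∀ t, ψ (of K t) = extend K f t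
  | .node d ts => by
    have ih : ∀ t ∈ ts, ψ (of K t) = extend K f t := fun t _ => eq_extend h h' t
    rw [← brace_root, h, h', extend, List.map_map]
    congr 1
    exact List.map_congr_left ih
termination_by t => t

theorem lin_extend_brace (f : D → B) (as : List (Br K D)) (c : Br K D) :
    lin K (extend K f) (BraceAlgebra.brace K as c) =
      BraceAlgebra.brace K (as.map (lin K (extend K f))) (lin K (extend K f) c) := by
  let φ := lin K (extend K f)
  let rhs (l : List B) : B →ₗ[K] B :=
    { toFun := BraceAlgebra.brace K l
      map_add' := BraceAlgebra.brace_add_right l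
      map_smul' := fun k c => BraceAlgebra.brace_smul_right k l c }
  suffices H : φ ∘ₗ braceLin as = rhs (as.map φ) ∘ₗ φ from LinearMap.congr_fun H c
  refine hom_ext fun t => ?_
  have h₁ : IsSeqLinear K fun as : List (Br K D) =>
      BraceAlgebra.brace K (as.map φ) (φ (of K t)) :=
    ⟨fun l a a' r => by simp [BraceAlgebra.brace_add_left],
      fun k l a r => by simp [BraceAlgebra.brace_smul_left]⟩
  refine seqLinear_ext ((isSeqLinear_brace (of K t)).comp φ) h₁ (fun F => ?_) as
  rw [brace_of, msum_hom φ]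
  simp only [φ, lin_of, List.map_map, msum_graft_extend]
  congr 1
  exact List.map_congr_left fun t _ => (lin_of _ t).symm

/-- `Br K D` is the free brace algebra generated by `D`. -/
theorem isFreeBraceAlgebra (K : Type u) (D : Type v) [Field K] :
    IsFreeBraceAlgebra.{u, v, max u v, x} K fun d : D => of K (.node d []) := by
  intro B _ _ _ f
  refine ⟨lin K (extend K f), ⟨lin_extend_brace f, fun d => ?_⟩, fun ψ hψ => ?_⟩
  · simp [lin_of, extend, BraceAlgebra.brace_nil]
  · exact hom_ext fun t => (eq_extend hψ.1 hψ.2 t).trans (lin_of _ t).symm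

end

/-! ### The root grafting product and the bigrading -/

/-- The product `⋆`: for planar trees, `t ⋆ t'` is the sum of the graftings of `t` on the root of
`t'`. -/
noncomputable def star : Br K D →ₗ[K] Br K D →ₗ[K] Br K D :=
  lin K fun t => lin K fun t' => ((PlanarTree.rootGraft t t').map (of K)).sum

/-- The subspace `Br(D) ⋆ Br(D)`. -/
noncomputable def starRange (K : Type u) (D : Type v) [Field K] : Submodule K (Br K D) :=
  Submodule.span K {z | ∃ x y, z = star x y}

/-- The component of bidegree `(k, l)`, spanned by the planar trees with `k` vertices and whose root
has fertility `l`. -/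
noncomputable def component (K : Type u) (D : Type v) [Field K] (k l : ℕ) : Submodule K (Br K D) :=
  Submodule.span K {z | ∃ t : PlanarTree D, t.weight = k ∧ t.rootFertility = l ∧ z = of K t}

/-- A subspace is bigraded if it is the sum of its intersections with the components. -/
def IsBigraded (V : Submodule K (Br K D)) : Prop :=
  V = ⨆ k : ℕ, ⨆ l : ℕ, V ⊓ component K D k l

end Br

open TensorProduct

/-! Freeness follows from two facts about the product map m : Br ⊗ Br → Br. First, V and the image
of m span Br (`filt_le_sup_map_mulMap`). Second, every ξ with m(ξ) ∈ V is a combination of the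
pre-Lie relations x ⊗ yz − y ⊗ xz − (xy − yx) ⊗ z (`mem_relSpan_of_mulMap_mem`); thus V meets the
image of m only in 0, and products satisfy no relations beyond the pre-Lie identity.

Both facts come from the filtration by root fertility, for which ⋆ is the leading part of the
product and x ⋆ (y ⋆ z) = y ⋆ (x ⋆ z) the leading part of the pre-Lie identity. That commutation
gives all the relations of ⋆ is shown by a Koszul-type argument. Cutting off the leftmost subtree
and grafting it again on the root is an operator R with R(x ⋆ y) = x ⋆ R(y) + x ⋆ y, so on fertility
less than n it is killed by X(X − 1)⋯(X − n + 1). Cutting after ⋆ is 1 + id ⊗ R modulo commutation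
relations, and in characteristic zero 1 + id ⊗ R is invertible on pairs of bounded fertility. Hence
an element killed by ⋆ is a combination of commutation relations; descending on fertility lifts this
to m.

Given a linear map f on V, a decomposition z = τ(z) + m(σ(z)) with τ(z) ∈ V forces φ(z) = f(τ z) +
(φ ⊗ φ)(σ z) multiplied in P. This recursion on the weight has exactly one solution. The solution is
a morphism because ξ and σ(m(ξ)) differ by pre-Lie relations, which also hold in P. -/

theorem ssum_hom {α : Type u} {M : Type v} {N : Type w} [AddCommMonoid M] [AddCommMonoid N]
    {F : Type*} [FunLike F M N] [AddMonoidHomClass F M N] (φ : F) (l : List α)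
    (f : List α → List α → M) : φ (ssum l f) = ssum l fun x y => φ (f x y) :=
  msum_hom φ _ _

/-! ### Weight and root fertility under graftings. -/

namespace PlanarTree

variable {D : Type u}

theorem weight_node (d : D) (ts : List (PlanarTree D)) :
    (node d ts).weight = 1 + (ts.map weight).sum := by
  rw [weight]

theorem weight_pos (t : PlanarTree D) : 0 < t.weight := by
  obtain ⟨d, ts⟩ := t
  rw [weight_node]
  omega

theorem length_le_sum_weight (ts : List (PlanarTree D)) : ts.length ≤ (ts.map weight).sum := by
  induction ts with
  | nil => simp
  | cons t ts ih =>
    have := t.weight_pos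
    simp only [List.length_cons, List.map_cons, List.sum_cons]
    omega

theorem rootFertility_lt_weight (t : PlanarTree D) : t.rootFertility < t.weight := by
  obtain ⟨d, ts⟩ := t
  have := length_le_sum_weight ts
  simp only [rootFertility, weight_node]
  omega

theorem mem_splits {α : Type v} {l : List α} {p : List α × List α} (h : p ∈ splits l) :
    p.1 ++ p.2 = l := by
  induction l generalizing p with
  | nil => simp_all [splits]
  | cons a l ih =>
    simp only [splits, List.mem_cons, List.mem_map] at h
    rcases h with rfl | ⟨q, hq, rfl⟩
    · rfl
    · simp [ih hq]

theorem weight_rootFertility_of_mem_rootGraft {s t r : PlanarTree D} (h : r ∈ rootGraft s t) :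
    r.weight = s.weight + t.weight ∧ r.rootFertility = t.rootFertility + 1 := by
  obtain ⟨d, ts⟩ := t
  simp only [rootGraft, Multiset.mem_coe, List.mem_map] at h
  obtain ⟨p, hp, rfl⟩ := h
  have := mem_splits hp
  subst this
  simp [weight_node, rootFertility]
  omega

/-- Graftings of one tree over a forest which do not add a tree to the forest. -/
def innerGraft (s : PlanarTree D) : List (PlanarTree D) → Multiset (List (PlanarTree D))
  | [] => 0
  | t :: G => (innerGraft s G).map (t :: ·) + (graft [s] t).map (· :: G)

/-- Under a common root, the first sum becomes ⋆ and the second keeps the fertility. This is what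
makes ⋆ the leading part of the pre-Lie product. -/
theorem msum_graftForest_singleton {M : Type v} [AddCommMonoid M] (s : PlanarTree D)
    (G : List (PlanarTree D)) (h : List (PlanarTree D) → M) :
    msum (graftForest [s] G) h =
      (ssum G fun u v => h (u ++ s :: v)) + msum (innerGraft s G) h := by
  induction G generalizing h with
  | nil =>
    rw [msum_graftForest_nil]
    simp [ssum_nil, innerGraft, msum]
  | cons t G ih =>
    have h₀ : graft [] t = {t} := by
      obtain ⟨d, ts⟩ := t
      simp [graft, graftForest_nil_left]
    simp only [msum_graftForest_cons, ssum_cons, ssum_nil, innerGraft, msum_add_family, msum_map,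
      h₀, msum_singleton, graftForest_nil_left, ih]
    simp only [List.nil_append, List.cons_append]
    abel

theorem weight_of_mem_graft (s : PlanarTree D) : ∀ t : PlanarTree D, ∀ r ∈ graft [s] t,
    r.weight = s.weight + t.weight
  | node d ts => by
    have ih : ∀ t ∈ ts, ∀ r ∈ graft [s] t, r.weight = s.weight + t.weight :=
      fun t _ => weight_of_mem_graft s t
    suffices H : ∀ H ∈ graftForest [s] ts, (H.map weight).sum = s.weight + (ts.map weight).sum by
      intro r hr
      simp only [graft, Multiset.mem_map] at hr
      obtain ⟨H', hH', rfl⟩ := hr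
      simp only [weight_node, H H' hH']
      omega
    clear d
    induction ts with
    | nil => simp [graftForest]
    | cons t G ihG =>
      intro H hH
      obtain ⟨d, ts⟩ := t
      have hG := ihG fun t ht => ih t (by simp [ht])
      have ht := ih (node d ts) (by simp)
      simp only [graft, Multiset.mem_map] at ht
      simp only [graftForest, splits, List.map_cons, List.map_nil, Multiset.mem_bind,
        Multiset.mem_coe, List.mem_cons, List.not_mem_nil, or_false, Multiset.mem_map] at hH
      obtain ⟨p, rfl | rfl, hH⟩ := hH
      -- Here `s` is not inserted before the first tree: `q` decides whether it goes to the
      -- remaining trees or over the first one.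
      · obtain ⟨q, hq, us, hus, H', hH', rfl⟩ := hH
        simp only [splits, List.map_cons, List.map_nil, List.mem_cons, List.not_mem_nil,
          or_false] at hq
        rcases hq with rfl | rfl
        · simp only [graftForest_nil_left, Multiset.mem_singleton] at hus
          subst hus
          simp [hG H' hH']
          omega
        · simp only [graftForest_nil_left, Multiset.mem_singleton] at hH'
          subst hH'
          simp [ht _ ⟨us, hus, rfl⟩]
          omega
      · obtain ⟨q, hq, us, hus, H', hH', rfl⟩ := hH
        simp only [splits, List.mem_cons, List.not_mem_nil, or_false] at hq
        subst hq
        simp only [graftForest_nil_left, Multiset.mem_singleton] at hus hH'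
        subst hus hH'
        simp

theorem weight_length_of_mem_innerGraft (s : PlanarTree D) {G H : List (PlanarTree D)}
    (h : H ∈ innerGraft s G) :
    (H.map weight).sum = s.weight + (G.map weight).sum ∧ H.length = G.length := by
  induction G generalizing H with
  | nil => simp [innerGraft] at h
  | cons t G ih =>
    simp only [innerGraft, Multiset.mem_add, Multiset.mem_map] at h
    rcases h with ⟨H', hH', rfl⟩ | ⟨u, hu, rfl⟩
    · have := ih hH'
      simp
      omega
    · have := weight_of_mem_graft s t u hu
      simp
      omega

end PlanarTree

/-! ### The product ⋆ and the cutting of the leftmost subtree. -/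

namespace Br

open PlanarTree

variable {K : Type u} {D : Type v} [Field K]

theorem star_of_node (s : PlanarTree D) (d : D) (ts : List (PlanarTree D)) :
    star (of K s) (of K (node d ts)) = ssum ts fun u v => of K (node d (u ++ s :: v)) := by
  simp [star, lin_of, rootGraft, ssum, msum, Function.comp_def]

theorem star_of_of (s t : PlanarTree D) :
    star (of K s) (of K t) = msum (rootGraft s t) (of K) := by
  simp [star, lin_of, msum]

theorem of_mul_of_node (s : PlanarTree D) (d : D) (ts : List (PlanarTree D)) :
    of K s * of K (node d ts) = star (of K s) (of K (node d ts)) +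
      msum (innerGraft s ts) fun H => of K (node d H) := by
  rw [star_of_node, ← msum_graftForest_singleton s ts fun H => of K (node d H), of_mul_of,
    ← msum_graft]
  rfl

/-- The tree grafted last falls to the left or to the right of the other one. The result is
symmetric in `r` and `s`, whence the commutation of the operators x ⋆ -. -/
theorem star_star_of_node (r s : PlanarTree D) (d : D) (ts : List (PlanarTree D)) :
    star (of K r) (star (of K s) (of K (node d ts))) =
      (ssum ts fun u p => ssum p fun v w => of K (node d (u ++ r :: v ++ s :: w))) +
        ssum ts fun u p => ssum p fun v w => of K (node d (u ++ s :: v ++ r :: w)) := by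
  rw [star_of_node, ssum_hom]
  simp only [star_of_node, ssum_append_cons, ssum_add]
  congr 1
  simp only [List.append_assoc, List.cons_append]
  exact ssum_ssum ts fun x y z => of K (node d (x ++ r :: (y ++ s :: z)))

theorem star_left_comm (x y z : Br K D) : star x (star y z) = star y (star x z) := by
  induction x using induction_on with
  | zero => simp
  | add a b ha hb => simp [ha, hb]
  | smul k r =>
    induction y using induction_on with
    | zero => simp
    | add a b ha hb => simp only [map_add, LinearMap.add_apply, ha, hb]
    | smul k s =>
      induction z using induction_on with
      | zero => simp
      | add a b ha hb => simp only [map_add, ha, hb]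
      | smul k t =>
        obtain ⟨d, ts⟩ := t
        simp only [map_smul, LinearMap.smul_apply, star_star_of_node]
        rw [add_comm]
        module

/-- The removal of the leftmost subtree attached to the root. -/
noncomputable def cutFirst : Br K D →ₗ[K] Br K D ⊗[K] Br K D :=
  lin K fun
    | node _ [] => 0
    | node d (t :: ts) => of K t ⊗ₜ of K (node d ts)

/-- The product `⋆` as a linear map on the tensor square. -/
noncomputable def starMap : Br K D ⊗[K] Br K D →ₗ[K] Br K D := TensorProduct.lift star

theorem starMap_tmul (x y : Br K D) : starMap (x ⊗ₜ y) = star x y := rfl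

theorem cutFirst_nil (d : D) : cutFirst (of K (node d [])) = 0 := by
  simp [cutFirst, lin_of]

theorem cutFirst_cons (d : D) (t : PlanarTree D) (ts : List (PlanarTree D)) :
    cutFirst (of K (node d (t :: ts))) = of K t ⊗ₜ of K (node d ts) := by
  simp [cutFirst, lin_of]

/-- Either `x` is inserted in the leftmost position and is the subtree cut off, or it lands further
right and its insertion commutes with the cut. -/
theorem cutFirst_star (x y : Br K D) :
    cutFirst (star x y) = x ⊗ₜ y + (star x).lTensor (Br K D) (cutFirst y) := by
  suffices H : ∀ s t : PlanarTree D, cutFirst (star (of K s) (of K t)) =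
      of K s ⊗ₜ of K t + (star (of K s)).lTensor (Br K D) (cutFirst (of K t)) by
    induction x using induction_on with
    | zero => simp
    | add a b ha hb =>
      simp only [map_add, LinearMap.add_apply, ha, hb, add_tmul, LinearMap.lTensor_add]
      abel
    | smul k s =>
      induction y using induction_on with
      | zero => simp
      | add a b ha hb =>
        simp only [map_add, ha, hb, tmul_add]
        abel
      | smul k' t =>
        simp only [map_smul, LinearMap.smul_apply, H, LinearMap.lTensor_smul, smul_tmul,
          tmul_smul, smul_add]
  rintro s ⟨d, _ | ⟨t, ts⟩⟩
  · simp [star_of_node, ssum_nil, cutFirst_cons, cutFirst_nil]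
  · rw [star_of_node, ssum_cons, map_add, ssum_hom cutFirst]
    simp only [List.nil_append, List.cons_append, cutFirst_cons, LinearMap.lTensor_tmul,
      star_of_node]
    congr 1
    exact (ssum_hom (TensorProduct.mk K (Br K D) (Br K D) (of K t)) _ _).symm

/-- The leftmost subtree attached to the root is grafted again on the root. -/
noncomputable def regraft : Module.End K (Br K D) := starMap ∘ₗ cutFirst

/-- The operator `regraft` acts like a number operator that x ⋆ - raises by one. The first term
comes from commuting x ⋆ - past the regrafting of the subtree cut from `y`. -/
theorem regraft_star (x y : Br K D) : regraft (star x y) = star x (regraft y) + star x y := by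
  have key : starMap ∘ₗ (star x).lTensor (Br K D) = star x ∘ₗ starMap := by
    ext a b
    exact star_left_comm a x b
  simp only [regraft, LinearMap.comp_apply, cutFirst_star, map_add, starMap_tmul]
  rw [add_comm]
  exact congrArg (· + _) (LinearMap.congr_fun key (cutFirst y))

end Br

/-! ### Inverting 1 + A when A is killed by a falling factorial. -/

namespace Br

open PlanarTree

section

variable {K : Type u} [Field K] {M : Type v} {N : Type w} [AddCommGroup M] [Module K M]
  [AddCommGroup N] [Module K N]

theorem aeval_intertwine {A : Module.End K M} {B : Module.End K N} {f : M →ₗ[K] N}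
    (h : ∀ m, f (A m) = B (f m)) (p : Polynomial K) (m : M) :
    f (Polynomial.aeval A p m) = Polynomial.aeval B p (f m) := by
  induction p using Polynomial.induction_on' generalizing m with
  | add p q hp hq => simp [hp, hq]
  | monomial n a =>
    have H : ∀ (n : ℕ) (m : M), f ((A ^ n) m) = (B ^ n) (f m) := by
      intro n
      induction n with
      | zero => simp
      | succ n ih => intro m; simp [pow_succ, ih, h]
    simp [Polynomial.aeval_monomial, H]

/-- Modulo `S`, `A` acts on `m` as −1, so the falling factorial acts as its value (−1)ⁿ n! at −1,
which is nonzero in characteristic zero. -/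
theorem mem_of_add_mem_of_descPochhammer [CharZero K] {A : Module.End K M} {S : Submodule K M}
    (hS : ∀ m ∈ S, A m ∈ S) {m : M} (hm : A m + m ∈ S) {n : ℕ}
    (h : Polynomial.aeval A (descPochhammer K n) m = 0) : m ∈ S := by
  have key : ∀ n : ℕ, ∃ c : K, c ≠ 0 ∧ Polynomial.aeval A (descPochhammer K n) m - c • m ∈ S := by
    intro n
    induction n with
    | zero => exact ⟨1, one_ne_zero, by simp⟩
    | succ n ih =>
      obtain ⟨c, hc, hc'⟩ := ih
      -- The new factor X − n takes the value −(n + 1) at −1.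
      refine ⟨-(n + 1) * c, mul_ne_zero (neg_ne_zero.2 (by exact_mod_cast n.succ_ne_zero)) hc, ?_⟩
      have h₁ := S.sub_mem (hS _ hc') (S.smul_mem (n : K) hc')
      have h₂ := S.add_mem h₁ (S.smul_mem c hm)
      rw [descPochhammer_succ_right, mul_comm, map_mul, Module.End.mul_apply]
      simp only [map_sub, Polynomial.aeval_X, map_natCast, LinearMap.sub_apply,
        Module.End.natCast_apply, map_smul] at h₂ ⊢
      convert h₂ using 1
      rw [← Nat.cast_smul_eq_nsmul K]
      module
  obtain ⟨c, hc, hc'⟩ := key n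
  rw [h, zero_sub, neg_mem_iff] at hc'
  simpa [hc] using S.smul_mem c⁻¹ hc'

end

/-! ### The filtration by weight and root fertility. -/

variable {K : Type u} {D : Type v} [Field K]

/-- The subspace spanned by the planar trees with at most `k` vertices and fertility of the root
less than `n`. -/
noncomputable def filt (K : Type u) (D : Type v) [Field K] (k n : ℕ) : Submodule K (Br K D) :=
  Submodule.span K {z | ∃ t : PlanarTree D, t.weight ≤ k ∧ t.rootFertility < n ∧ z = of K t}

/-- The subspace of the tensor square spanned by the pairs of planar trees with at most `k`
vertices, the fertility of the root of the second one being less than `n`. -/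
noncomputable def pairFilt (K : Type u) (D : Type v) [Field K] (k n : ℕ) :
    Submodule K (Br K D ⊗[K] Br K D) :=
  Submodule.span K {z | ∃ s t : PlanarTree D,
    s.weight + t.weight ≤ k ∧ t.rootFertility < n ∧ z = of K s ⊗ₜ of K t}

theorem of_mem_filt {k n : ℕ} {t : PlanarTree D} (h : t.weight ≤ k) (h' : t.rootFertility < n) :
    of K t ∈ filt K D k n :=
  Submodule.subset_span ⟨t, h, h', rfl⟩

theorem of_tmul_of_mem_pairFilt {k n : ℕ} {s t : PlanarTree D} (h : s.weight + t.weight ≤ k)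
    (h' : t.rootFertility < n) : of K s ⊗ₜ of K t ∈ pairFilt K D k n :=
  Submodule.subset_span ⟨s, t, h, h', rfl⟩

theorem filt_mono {k k' n n' : ℕ} (h : k ≤ k') (h' : n ≤ n') : filt K D k n ≤ filt K D k' n' :=
  Submodule.span_mono fun _ ⟨t, ht, ht', e⟩ => ⟨t, ht.trans h, ht'.trans_le h', e⟩

theorem pairFilt_mono {k k' n n' : ℕ} (h : k ≤ k') (h' : n ≤ n') :
    pairFilt K D k n ≤ pairFilt K D k' n' :=
  Submodule.span_mono fun _ ⟨s, t, ht, ht', e⟩ => ⟨s, t, ht.trans h, ht'.trans_le h', e⟩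

theorem pairFilt_le {k n : ℕ} {S : Submodule K (Br K D ⊗[K] Br K D)}
    (h : ∀ s t : PlanarTree D, s.weight + t.weight ≤ k → t.rootFertility < n →
      of K s ⊗ₜ of K t ∈ S) : pairFilt K D k n ≤ S := by
  refine Submodule.span_le.2 ?_
  rintro _ ⟨s, t, h₁, h₂, rfl⟩
  exact h s t h₁ h₂

theorem filt_le {k n : ℕ} {S : Submodule K (Br K D)}
    (h : ∀ t : PlanarTree D, t.weight ≤ k → t.rootFertility < n → of K t ∈ S) :
    filt K D k n ≤ S := by
  refine Submodule.span_le.2 ?_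
  rintro _ ⟨t, h₁, h₂, rfl⟩
  exact h t h₁ h₂

theorem msum_mem {α : Type w} {S : Submodule K (Br K D)} {s : Multiset α} {f : α → Br K D}
    (h : ∀ a ∈ s, f a ∈ S) : msum s f ∈ S := by
  refine multiset_sum_mem _ fun z hz => ?_
  obtain ⟨a, ha, rfl⟩ := Multiset.mem_map.1 hz
  exact h a ha

theorem star_of_mem_filt (s : PlanarTree D) {t : PlanarTree D} {k n : ℕ}
    (hk : s.weight + t.weight ≤ k) (hn : t.rootFertility < n) :
    star (of K s) (of K t) ∈ filt K D k (n + 1) := by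
  rw [star_of_of]
  refine msum_mem fun r hr => ?_
  obtain ⟨h₁, h₂⟩ := weight_rootFertility_of_mem_rootGraft hr
  exact of_mem_filt (by omega) (by omega)

/-- Only the graftings away from the root remain, and these do not change the fertility of the root.
-/
theorem mul_sub_star_mem_filt (s : PlanarTree D) {t : PlanarTree D} {k n : ℕ}
    (hk : s.weight + t.weight ≤ k) (hn : t.rootFertility < n) :
    of K s * of K t - star (of K s) (of K t) ∈ filt K D k n := by
  obtain ⟨d, ts⟩ := t
  rw [of_mul_of_node, add_sub_cancel_left]
  refine msum_mem fun H hH => ?_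
  obtain ⟨h₁, h₂⟩ := weight_length_of_mem_innerGraft s hH
  simp only [weight_node, rootFertility] at hk hn
  refine of_mem_filt ?_ ?_
  · simp only [weight_node]
    omega
  · simp only [rootFertility]
    omega

/-- The pre-Lie product as a linear map on the tensor square. -/
noncomputable def mulMap : Br K D ⊗[K] Br K D →ₗ[K] Br K D := LinearMap.mul' K (Br K D)

theorem mulMap_tmul (x y : Br K D) : mulMap (x ⊗ₜ[K] y) = x * y := rfl

theorem mulMap_sub_starMap_mem {k n : ℕ} {ξ : Br K D ⊗[K] Br K D} (hξ : ξ ∈ pairFilt K D k n) :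
    mulMap ξ - starMap ξ ∈ filt K D k n := by
  suffices H : pairFilt K D k n ≤ (filt K D k n).comap (mulMap - starMap) from H hξ
  exact pairFilt_le fun s t hk hn => mul_sub_star_mem_filt s hk hn

theorem starMap_mem {k n : ℕ} {ξ : Br K D ⊗[K] Br K D} (hξ : ξ ∈ pairFilt K D k n) :
    starMap ξ ∈ filt K D k (n + 1) := by
  suffices H : pairFilt K D k n ≤ (filt K D k (n + 1)).comap starMap from H hξ
  exact pairFilt_le fun s t hk hn => star_of_mem_filt s hk hn

theorem mulMap_mem {k n : ℕ} {ξ : Br K D ⊗[K] Br K D} (hξ : ξ ∈ pairFilt K D k n) :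
    mulMap ξ ∈ filt K D k (n + 1) := by
  have := add_mem (filt_mono le_rfl n.le_succ (mulMap_sub_starMap_mem hξ)) (starMap_mem hξ)
  simpa using this

theorem cutFirst_mem {k n : ℕ} {x : Br K D} (hx : x ∈ filt K D k (n + 1)) :
    cutFirst x ∈ pairFilt K D k n := by
  suffices H : filt K D k (n + 1) ≤ (pairFilt K D k n).comap cutFirst from H hx
  refine filt_le ?_
  rintro ⟨d, _ | ⟨t, ts⟩⟩ hk hn
  · simp [cutFirst_nil]
  · rw [Submodule.mem_comap, cutFirst_cons]
    simp only [weight_node, rootFertility, List.map_cons, List.sum_cons, List.length_cons] at hk hn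
    refine of_tmul_of_mem_pairFilt ?_ ?_
    · rw [weight_node]; omega
    · simp only [rootFertility]; omega

theorem regraft_mem {k n : ℕ} {x : Br K D} (hx : x ∈ filt K D k n) :
    regraft x ∈ filt K D k n := by
  obtain _ | n := n
  · have : filt K D k 0 ≤ ⊥ := filt_le fun t _ h => absurd h (by omega)
    rw [(Submodule.mem_bot K).1 (this hx), map_zero]
    exact zero_mem _
  · exact starMap_mem (cutFirst_mem hx)

/-- The operator `regraft` on the second factor of the tensor square. -/
noncomputable def regraftRight : Module.End K (Br K D ⊗[K] Br K D) :=
  regraft.lTensor (Br K D)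

theorem aeval_regraftRight_eq_zero {p : Polynomial K} {k n : ℕ}
    (hp : ∀ x ∈ filt K D k n, Polynomial.aeval regraft p x = 0) {ξ : Br K D ⊗[K] Br K D}
    (hξ : ξ ∈ pairFilt K D k n) : Polynomial.aeval regraftRight p ξ = 0 := by
  suffices H : pairFilt K D k n ≤ LinearMap.ker (Polynomial.aeval (regraftRight (K := K) (D := D)) p) from
    H hξ
  refine pairFilt_le fun s t hk hn => ?_
  have := aeval_intertwine (A := regraft (K := K)) (B := regraftRight)
    (f := TensorProduct.mk K (Br K D) (Br K D) (of K s)) (fun _ => rfl) p (of K t)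
  rw [hp _ (of_mem_filt (by omega) hn), map_zero] at this
  exact this.symm

/-- With R = `regraft`, the identity R(x ⋆ y) = x ⋆ R(y) + x ⋆ y says that `starMap` intertwines id
⊗ R with R − 1. Since R factors through `cutFirst`, which lowers the fertility bound, X · p(X − 1)
kills the next step of the filtration as soon as p kills the present one. -/
theorem aeval_regraft_descPochhammer {k n : ℕ} {x : Br K D} (hx : x ∈ filt K D k n) :
    Polynomial.aeval regraft (descPochhammer K n) x = 0 := by
  induction n generalizing x with
  | zero =>
    have : filt K D k 0 ≤ ⊥ := filt_le fun t _ h => absurd h (by omega)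
    rw [(Submodule.mem_bot K).1 (this hx), map_zero]
  | succ n ih =>
    have key : ∀ ξ : Br K D ⊗[K] Br K D, starMap (regraftRight ξ) = (regraft - 1) (starMap ξ) := by
      refine LinearMap.congr_fun (f := starMap ∘ₗ regraftRight (K := K) (D := D))
        (g := (regraft - 1) ∘ₗ starMap) ?_
      ext a b
      simp only [curry_apply, LinearMap.comp_apply,
        TensorProduct.AlgebraTensorModule.curry_apply, LinearMap.coe_restrictScalars,
        LinearMap.sub_apply, Module.End.one_apply, starMap_tmul, regraft_star]
      simp [regraftRight, starMap_tmul]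
    rw [descPochhammer_succ_left, mul_comm, map_mul, Module.End.mul_apply, Polynomial.aeval_X,
      Polynomial.aeval_comp]
    simp only [map_sub, map_one, Polynomial.aeval_X]
    rw [regraft, LinearMap.comp_apply, ← regraft, ← aeval_intertwine key,
      aeval_regraftRight_eq_zero (fun _ => ih) (cutFirst_mem hx), map_zero]

end Br

/-! ### Pre-Lie relations and the relations of ⋆. -/

theorem mul_mul_sub_mul_mul_sub_commutator_mul {L : Type u} [LeftPreLieRing L] (x y z : L) :
    x * (y * z) - y * (x * z) - (x * y - y * x) * z = 0 := by
  have := LeftPreLieRing.assoc_symm x y z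
  simp only [associator_apply] at this
  rw [← sub_eq_zero] at this
  rw [← neg_eq_zero, ← this, sub_mul]
  abel

namespace Br

open PlanarTree

variable {K : Type u} {D : Type v} [Field K]

/-- The relation in the kernel of the product coming from the pre-Lie identity. -/
noncomputable def preLieRel (x y z : Br K D) : Br K D ⊗[K] Br K D :=
  x ⊗ₜ (y * z) - y ⊗ₜ (x * z) - (x * y - y * x) ⊗ₜ z

/-- The relation in the kernel of `⋆` coming from the commutation of the operators `x ⋆ -`. -/
noncomputable def starRel (x y : Br K D) : Br K D →ₗ[K] Br K D ⊗[K] Br K D :=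
  TensorProduct.mk K _ _ x ∘ₗ star y - TensorProduct.mk K _ _ y ∘ₗ star x

theorem starRel_apply (x y z : Br K D) :
    starRel x y z = x ⊗ₜ star y z - y ⊗ₜ star x z := rfl

/-- The span of the pre-Lie relations of weight at most `k`. -/
noncomputable def relSpan (K : Type u) (D : Type v) [Field K] (k : ℕ) :
    Submodule K (Br K D ⊗[K] Br K D) :=
  Submodule.span K {ρ | ∃ r s t : PlanarTree D,
    r.weight + s.weight + t.weight ≤ k ∧ ρ = preLieRel (of K r) (of K s) (of K t)}

/-- The span of the relations of `⋆` of weight at most `k`, the last root having fertility less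
than `n`. -/
noncomputable def starRelSpan (K : Type u) (D : Type v) [Field K] (k n : ℕ) :
    Submodule K (Br K D ⊗[K] Br K D) :=
  Submodule.span K {ρ | ∃ r s t : PlanarTree D,
    r.weight + s.weight + t.weight ≤ k ∧ t.rootFertility < n ∧
      ρ = starRel (of K r) (of K s) (of K t)}

theorem starRel_mem {k j n : ℕ} {r s : PlanarTree D} {z : Br K D} (hz : z ∈ filt K D j n)
    (hk : r.weight + s.weight + j ≤ k) : starRel (of K r) (of K s) z ∈ starRelSpan K D k n := by
  suffices H : filt K D j n ≤ (starRelSpan K D k n).comap (starRel (of K r) (of K s)) from H hz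
  exact filt_le fun t ht hn => Submodule.subset_span ⟨r, s, t, by omega, hn, rfl⟩

/-- By `regraft_star`, the operator moves inside the relation, so the span of the relations is
stable under it. -/
theorem regraftRight_starRel (x y z : Br K D) :
    regraftRight (starRel x y z) = starRel x y (regraft z + z) := by
  simp only [starRel_apply, regraftRight, map_sub, LinearMap.lTensor_tmul, regraft_star, map_add,
    tmul_add]
  abel

theorem regraftRight_mem {k n : ℕ} {ξ : Br K D ⊗[K] Br K D}
    (hξ : ξ ∈ starRelSpan K D k n ⊔ pairFilt K D k n) :
    regraftRight ξ ∈ starRelSpan K D k n ⊔ pairFilt K D k n := by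
  suffices H : starRelSpan K D k n ⊔ pairFilt K D k n ≤
      (starRelSpan K D k n ⊔ pairFilt K D k n).comap regraftRight from H hξ
  refine sup_le (Submodule.span_le.2 ?_) (pairFilt_le fun s t hk hn => ?_)
  · rintro _ ⟨r, s, t, hk, hn, rfl⟩
    have ht := of_mem_filt (K := K) le_rfl hn
    rw [SetLike.mem_coe, Submodule.mem_comap, regraftRight_starRel]
    exact Submodule.mem_sup_left (starRel_mem (add_mem (regraft_mem ht) ht) hk)
  · refine Submodule.mem_sup_right ?_
    have ht := regraft_mem (of_mem_filt (K := K) (le_refl t.weight) hn)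
    suffices H : filt K D t.weight n ≤
        (pairFilt K D k n).comap (TensorProduct.mk K _ _ (of K s)) from H ht
    exact filt_le fun t' h' hn' => of_tmul_of_mem_pairFilt (by omega) hn'

/-- On s ⊗ B_d(t t₂⋯tₙ) the discrepancy is t ⊗ (s ⋆ b) − s ⊗ (t ⋆ b) with b = B_d(t₂⋯tₙ): the term
left by the cut against the one produced by regrafting. This is a commutation relation. -/
theorem cutFirst_starMap_sub_mem {k n : ℕ} {ξ : Br K D ⊗[K] Br K D}
    (hξ : ξ ∈ pairFilt K D k (n + 1)) :
    cutFirst (starMap ξ) - (regraftRight ξ + ξ) ∈ starRelSpan K D k n := by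
  suffices H : pairFilt K D k (n + 1) ≤ (starRelSpan K D k n).comap
      (cutFirst ∘ₗ starMap - (regraftRight + LinearMap.id)) from H hξ
  refine pairFilt_le ?_
  rintro s ⟨d, _ | ⟨t, ts⟩⟩ hk hn
  · simp [starMap_tmul, cutFirst_star, cutFirst_nil, regraftRight, regraft]
  · have : ((cutFirst ∘ₗ starMap - (regraftRight + LinearMap.id) :
        Br K D ⊗[K] Br K D →ₗ[K] Br K D ⊗[K] Br K D))
        (of K s ⊗ₜ of K (node d (t :: ts))) = starRel (of K t) (of K s) (of K (node d ts)) := by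
      simp only [LinearMap.sub_apply, LinearMap.comp_apply, LinearMap.add_apply, LinearMap.id_apply,
        starMap_tmul, cutFirst_star, regraftRight, LinearMap.lTensor_tmul, regraft, cutFirst_cons,
        starRel_apply]
      abel
    rw [Submodule.mem_comap, this]
    simp only [weight_node, List.map_cons, List.sum_cons, rootFertility, List.length_cons] at hk hn
    refine Submodule.subset_span ⟨t, s, node d ts, ?_, ?_, rfl⟩
    · rw [weight_node]; omega
    · simp only [rootFertility]; omega

theorem tmul_mem_pairFilt {k n j : ℕ} (s : PlanarTree D) {y : Br K D} (hy : y ∈ filt K D j n)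
    (hk : s.weight + j ≤ k) : of K s ⊗ₜ y ∈ pairFilt K D k n := by
  suffices H : filt K D j n ≤ (pairFilt K D k n).comap (TensorProduct.mk K _ _ (of K s)) from H hy
  exact filt_le fun t' h' hn' => of_tmul_of_mem_pairFilt (by omega) hn'

theorem tmul_mem_pairFilt_left {k n j m : ℕ} {t : PlanarTree D} {y : Br K D}
    (hy : y ∈ filt K D j m) (hk : j + t.weight ≤ k) (hn : t.rootFertility < n) :
    y ⊗ₜ of K t ∈ pairFilt K D k n := by
  suffices H : filt K D j m ≤
      (pairFilt K D k n).comap ((TensorProduct.mk K _ _).flip (of K t)) from H hy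
  exact filt_le fun t' h' _ => of_tmul_of_mem_pairFilt (by omega) hn

theorem mul_mem_filt (s : PlanarTree D) {t : PlanarTree D} {k n : ℕ}
    (hk : s.weight + t.weight ≤ k) (hn : t.rootFertility < n) :
    of K s * of K t ∈ filt K D k (n + 1) :=
  mulMap_mem (of_tmul_of_mem_pairFilt hk hn)

/-- Replacing ⋆ by the product costs only terms of lower fertility, and the commutator term of the
pre-Lie relation has the right factor `t`, of fertility less than `n`. -/
theorem starRelSpan_le (k n : ℕ) :
    starRelSpan K D k n ≤ relSpan K D k ⊔ pairFilt K D k n := by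
  refine Submodule.span_le.2 ?_
  rintro _ ⟨r, s, t, hk, hn, rfl⟩
  have e : starRel (of K r) (of K s) (of K t) = preLieRel (of K r) (of K s) (of K t) +
      (of K s ⊗ₜ (of K r * of K t - star (of K r) (of K t)) -
        of K r ⊗ₜ (of K s * of K t - star (of K s) (of K t)) +
          (of K r * of K s - of K s * of K r) ⊗ₜ of K t) := by
    rw [starRel_apply, preLieRel, tmul_sub, tmul_sub]
    abel
  rw [e, SetLike.mem_coe]
  refine add_mem (Submodule.mem_sup_left (Submodule.subset_span ⟨r, s, t, hk, rfl⟩))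
    (Submodule.mem_sup_right (add_mem (sub_mem ?_ ?_) ?_))
  · exact tmul_mem_pairFilt s (mul_sub_star_mem_filt r le_rfl hn) (by omega)
  · exact tmul_mem_pairFilt r (mul_sub_star_mem_filt s le_rfl hn) (by omega)
  · rw [sub_tmul]
    exact sub_mem
      (tmul_mem_pairFilt_left (mul_mem_filt r le_rfl (Nat.lt_succ_self _)) (by omega) hn)
      (tmul_mem_pairFilt_left (mul_mem_filt s le_rfl (Nat.lt_succ_self _)) (by omega) hn)

/-- The hypothesis says that the top-fertility part of the product of `ξ` vanishes. Then 1 + id ⊗ R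
sends `ξ` into commutation relations plus lower pairs, and inverting it on this stable subspace puts
`ξ` there too. -/
theorem mem_relSpan_sup_pairFilt [CharZero K] {k n : ℕ} {ξ : Br K D ⊗[K] Br K D}
    (hξ : ξ ∈ pairFilt K D k (n + 1)) (h : mulMap ξ ∈ filt K D k (n + 1)) :
    ξ ∈ relSpan K D k ⊔ pairFilt K D k n := by
  have h₁ : starMap ξ ∈ filt K D k (n + 1) := by
    have := sub_mem h (mulMap_sub_starMap_mem hξ)
    simpa using this
  have h₂ : regraftRight ξ + ξ ∈ starRelSpan K D k n ⊔ pairFilt K D k n := by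
    have := sub_mem (Submodule.mem_sup_right (cutFirst_mem h₁))
      (Submodule.mem_sup_left (T := pairFilt K D k n) (cutFirst_starMap_sub_mem hξ))
    simpa using this
  exact sup_le (starRelSpan_le k n) le_sup_right (mem_of_add_mem_of_descPochhammer
    (fun _ => regraftRight_mem) h₂
    (aeval_regraftRight_eq_zero (fun _ => aeval_regraft_descPochhammer) hξ))

theorem mulMap_preLieRel (x y z : Br K D) : mulMap (preLieRel x y z) = 0 := by
  simp only [preLieRel, map_sub, mulMap_tmul]
  exact mul_mul_sub_mul_mul_sub_commutator_mul x y z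

theorem mulMap_eq_zero_of_mem_relSpan {k : ℕ} {ρ : Br K D ⊗[K] Br K D} (h : ρ ∈ relSpan K D k) :
    mulMap ρ = 0 := by
  suffices H : relSpan K D k ≤ LinearMap.ker mulMap from H h
  refine Submodule.span_le.2 ?_
  rintro _ ⟨r, s, t, -, rfl⟩
  exact mulMap_preLieRel _ _ _

/-! ### Bigraded subspaces -/

open Classical in
/-- The projection on the span of the planar trees whose weight and fertility satisfy `p`. -/
noncomputable def proj (p : ℕ → ℕ → Prop) : Br K D →ₗ[K] Br K D :=
  lin K fun t => if p t.weight t.rootFertility then of K t else 0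

theorem proj_of (p : ℕ → ℕ → Prop) [DecidableRel p] (t : PlanarTree D) :
    proj p (of K t) = if p t.weight t.rootFertility then of K t else 0 := by
  simp [proj, lin_of]

theorem proj_of_mem_component (p : ℕ → ℕ → Prop) [DecidableRel p] {k l : ℕ} {x : Br K D}
    (hx : x ∈ component K D k l) : proj p x = if p k l then x else 0 := by
  suffices H : component K D k l ≤
      LinearMap.ker (proj p - if p k l then LinearMap.id else 0) by
    have := H hx
    rw [LinearMap.mem_ker, LinearMap.sub_apply, sub_eq_zero] at this
    split_ifs at this ⊢ <;> simpa using this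
  refine Submodule.span_le.2 ?_
  rintro _ ⟨t, rfl, rfl, rfl⟩
  rw [SetLike.mem_coe, LinearMap.mem_ker, LinearMap.sub_apply, proj_of]
  split_ifs <;> simp

theorem IsBigraded.proj_mem {V : Submodule K (Br K D)} (hV : IsBigraded V) (p : ℕ → ℕ → Prop)
    {x : Br K D} (hx : x ∈ V) : proj p x ∈ V := by
  classical
  suffices H : V ≤ V.comap (proj p) from H hx
  conv_lhs => rw [hV]
  refine iSup_le fun k => iSup_le fun l => ?_
  rintro y ⟨hy, hy'⟩
  rw [Submodule.mem_comap, proj_of_mem_component p hy']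
  split_ifs
  exacts [hy, zero_mem _]

theorem proj_star_of (p : ℕ → ℕ → Prop) [DecidableRel p] (s t : PlanarTree D) :
    proj p (star (of K s) (of K t)) =
      if p (s.weight + t.weight) (t.rootFertility + 1) then star (of K s) (of K t) else 0 := by
  rw [star_of_of, msum_hom (proj p)]
  have : ∀ r ∈ rootGraft s t, proj p (of K r) =
      if p (s.weight + t.weight) (t.rootFertility + 1) then of K r else 0 := by
    intro r hr
    obtain ⟨h₁, h₂⟩ := weight_rootFertility_of_mem_rootGraft hr
    rw [proj_of, h₁, h₂]
  rw [msum, Multiset.map_congr rfl this]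
  split_ifs <;> simp [msum]

theorem starMap_mem_starRange (ξ : Br K D ⊗[K] Br K D) : starMap ξ ∈ starRange K D := by
  induction ξ using TensorProduct.induction_on with
  | zero => simp
  | tmul x y => exact Submodule.subset_span ⟨x, y, rfl⟩
  | add a b ha hb => simpa using add_mem ha hb

/-- The top-fertility part of the product of `ξ` lies in `V`, which is graded, and in the range of
⋆, so it vanishes. Subtracting pre-Lie relations then lowers the fertility without changing the
product. -/
theorem mem_relSpan_of_mulMap_mem [CharZero K] {V : Submodule K (Br K D)} (hV : IsBigraded V)
    (hc : Disjoint V (starRange K D)) {k n : ℕ} {ξ : Br K D ⊗[K] Br K D}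
    (hξ : ξ ∈ pairFilt K D k n) (h : mulMap ξ ∈ V) : ξ ∈ relSpan K D k := by
  induction n generalizing ξ with
  | zero =>
    have : pairFilt K D k 0 ≤ ⊥ := pairFilt_le fun s t _ h => absurd h (by omega)
    rw [(Submodule.mem_bot K).1 (this hξ)]
    exact zero_mem _
  | succ n ih =>
    -- The fertility n + 1 is the largest that can occur in the product of `ξ`.
    have hlow : ∀ x ∈ filt K D k (n + 1), proj (fun _ l => l = n + 1) x = 0 := by
      suffices H : filt K D k (n + 1) ≤
        LinearMap.ker (proj (K := K) (D := D) fun _ l => l = n + 1) from H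
      refine filt_le fun t _ hn => ?_
      rw [LinearMap.mem_ker, proj_of, if_neg (by omega)]
    have hhigh : ∀ x ∈ filt K D k (n + 2), x - proj (fun _ l => l = n + 1) x ∈
        filt K D k (n + 1) := by
      suffices H : filt K D k (n + 2) ≤ (filt K D k (n + 1)).comap
        (LinearMap.id - proj (K := K) (D := D) fun _ l => l = n + 1) from H
      refine filt_le fun t hk hn => ?_
      rw [Submodule.mem_comap, LinearMap.sub_apply, LinearMap.id_apply, proj_of]
      split_ifs with hl
      · simp
      · simpa using of_mem_filt hk (by omega)
    have hstar : ∀ ξ ∈ pairFilt K D k (n + 1),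
        proj (fun _ l => l = n + 1) (starMap ξ) ∈ starRange K D := by
      suffices H : pairFilt K D k (n + 1) ≤
        (starRange K D).comap (proj (fun _ l => l = n + 1) ∘ₗ starMap) from H
      refine pairFilt_le fun s t _ _ => ?_
      rw [Submodule.mem_comap, LinearMap.comp_apply, starMap_tmul, proj_star_of]
      split_ifs
      exacts [starMap_mem_starRange (of K s ⊗ₜ of K t), zero_mem _]
    have hzero : proj (fun _ l => l = n + 1) (mulMap ξ) = 0 := by
      refine Submodule.disjoint_def.1 hc _ (hV.proj_mem _ h) ?_
      have := hlow _ (mulMap_sub_starMap_mem hξ)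
      rw [map_sub, sub_eq_zero] at this
      rw [this]
      exact hstar ξ hξ
    have hmem := hhigh _ (mulMap_mem hξ)
    rw [hzero, sub_zero] at hmem
    obtain ⟨ρ, hρ, ω, hω, rfl⟩ := Submodule.mem_sup.1 (mem_relSpan_sup_pairFilt hξ hmem)
    rw [map_add, mulMap_eq_zero_of_mem_relSpan hρ, zero_add] at h
    exact add_mem hρ (ih hω h)

/-- Decompose a tree along `V` and the range of ⋆, then replace ⋆ by the product: the error has
smaller fertility. Keeping the weight bound in the pairs is what permits a recursion on the weight
later. -/
theorem filt_le_sup_map_mulMap {V : Submodule K (Br K D)} (hV : IsBigraded V)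
    (hc : Codisjoint V (starRange K D)) (k n : ℕ) :
    filt K D k n ≤ V ⊔ (pairFilt K D k k).map mulMap := by
  induction n with
  | zero => exact filt_le fun t _ h => absurd h (by omega)
  | succ n ih =>
    refine filt_le fun t hk hn => ?_
    obtain hn | hn := Nat.lt_or_ge t.rootFertility n
    · exact ih (of_mem_filt hk hn)
    have hn : t.rootFertility = n := by omega
    -- The decomposition of the tree may involve other bidegrees; projecting on its own bidegree
    -- bounds the weight and the fertility of every pair.
    let p : ℕ → ℕ → Prop := fun i l => i = t.weight ∧ l = n
    have hstar : ∀ x ∈ starRange K D, proj p x ∈ V ⊔ (pairFilt K D k k).map mulMap := by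
      intro x hx
      suffices H : ∀ y : Br K D ⊗[K] Br K D,
          proj p (starMap y) ∈ V ⊔ (pairFilt K D k k).map mulMap by
        induction hx using Submodule.span_induction with
        | mem z hz =>
          obtain ⟨x, y, rfl⟩ := hz
          exact H (x ⊗ₜ y)
        | zero => simp
        | add a b _ _ ha hb => simpa using add_mem ha hb
        | smul c a _ ha => simpa using Submodule.smul_mem _ c ha
      intro y
      induction y using TensorProduct.induction_on with
      | zero => simp
      | add a b ha hb => simpa using add_mem ha hb
      | tmul a b =>
        induction a using induction_on with
        | zero => simp
        | add a b ha hb => simpa [add_tmul] using add_mem ha hb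
        | smul c s =>
          induction b using induction_on with
          | zero => simp
          | add a b ha hb => simpa [tmul_add] using add_mem ha hb
          | smul c' t' =>
            rw [← smul_tmul', tmul_smul, map_smul, map_smul, map_smul, map_smul]
            refine Submodule.smul_mem _ _ (Submodule.smul_mem _ _ ?_)
            rw [starMap_tmul, proj_star_of]
            split_ifs with hp
            · have h₁ := mul_sub_star_mem_filt (K := K) s (k := k) (n := n) (t := t')
                (by have := hp.1; omega) (by have := hp.2; omega)
              have h₂ : of K s ⊗ₜ of K t' ∈ pairFilt K D k k :=
                of_tmul_of_mem_pairFilt (by have := hp.1; omega)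
                  (by have := t'.rootFertility_lt_weight; have := hp.1; omega)
              have h₃ := Submodule.mem_sup_right (S := V) (Submodule.mem_map_of_mem (f := mulMap) h₂)
              rw [mulMap_tmul] at h₃
              simpa using sub_mem h₃ (ih h₁)
            · exact zero_mem _
    obtain ⟨v, hv, r, hr, e⟩ := Submodule.mem_sup.1
      (show of K t ∈ V ⊔ starRange K D from hc.eq_top ▸ Submodule.mem_top)
    have ht : of K t = proj p (of K t) := by
      rw [proj_of, if_pos ⟨rfl, hn⟩]
    rw [ht, ← e, map_add]
    exact add_mem (Submodule.mem_sup_left (hV.proj_mem p hv)) (hstar r hr)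

end Br

/-! ### Existence of a bigraded complement. -/

namespace Br

open PlanarTree

variable {K : Type u} {D : Type v} [Field K]

theorem of_mem_filt_self {k : ℕ} {t : PlanarTree D} (h : t.weight ≤ k) :
    of K t ∈ filt K D k k :=
  of_mem_filt h (t.rootFertility_lt_weight.trans_le h)

theorem exists_mem_filt (x : Br K D) : ∃ k, x ∈ filt K D k k := by
  induction x using induction_on with
  | zero => exact ⟨0, zero_mem _⟩
  | add a b ha hb =>
    obtain ⟨k, hk⟩ := ha
    obtain ⟨l, hl⟩ := hb
    exact ⟨max k l, add_mem (filt_mono (le_max_left _ _) (le_max_left _ _) hk)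
      (filt_mono (le_max_right _ _) (le_max_right _ _) hl)⟩
  | smul c t => exact ⟨t.weight, Submodule.smul_mem _ _ (of_mem_filt_self le_rfl)⟩

theorem exists_isBigraded_isCompl_starRange (K : Type u) (D : Type v) [Field K] :
    ∃ V : Submodule K (Br K D), IsBigraded V ∧ IsCompl V (starRange K D) := by
  let π := (starRange K D).mkQ
  -- A basis of the quotient is chosen among the classes of trees; its lift is spanned by trees,
  -- hence automatically bigraded.
  obtain ⟨κ, a, -, hspan, hli⟩ := exists_linearIndependent' K fun t : PlanarTree D => π (of K t)
  have htop : ⊤ ≤ Submodule.span K (Set.range ((fun t : PlanarTree D => π (of K t)) ∘ a)) := by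
    rw [hspan]
    intro q _
    obtain ⟨x, rfl⟩ := (starRange K D).mkQ_surjective q
    induction x using induction_on with
    | zero => simp
    | add a b ha hb => simpa using add_mem (ha trivial) (hb trivial)
    | smul c t =>
      rw [map_smul]
      exact Submodule.smul_mem _ _ (Submodule.subset_span ⟨t, rfl⟩)
  let b := Module.Basis.mk hli htop
  let σ : (Br K D ⧸ starRange K D) →ₗ[K] Br K D := b.constr K fun i => of K (a i)
  have hσ : ∀ q, π (σ q) = q := by
    refine LinearMap.congr_fun (f := π ∘ₗ σ) (g := LinearMap.id) (b.ext fun i => ?_)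
    simp only [LinearMap.comp_apply, σ, Module.Basis.constr_basis, LinearMap.id_apply]
    simp [b]
  refine ⟨LinearMap.range σ, le_antisymm ?_ (iSup_le fun k => iSup_le fun l => inf_le_left), ?_⟩
  · rw [Module.Basis.constr_range, Submodule.span_le]
    rintro _ ⟨i, rfl⟩
    refine Submodule.mem_iSup_of_mem _ (Submodule.mem_iSup_of_mem _
      ⟨Submodule.subset_span ⟨i, rfl⟩, Submodule.subset_span ⟨a i, rfl, rfl, rfl⟩⟩)
  · constructor
    · rw [Submodule.disjoint_def]
      rintro _ ⟨q, rfl⟩ hq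
      have := (Submodule.Quotient.mk_eq_zero _).2 hq
      rw [← hσ q, show π (σ q) = 0 from this, map_zero]
    · rw [codisjoint_iff, eq_top_iff]
      intro x _
      refine Submodule.mem_sup.2 ⟨σ (π x), ⟨_, rfl⟩, x - σ (π x), ?_, by abel⟩
      rw [← Submodule.Quotient.mk_eq_zero]
      change π (x - σ (π x)) = 0
      rw [map_sub, hσ, sub_self]

/-! ### Morphisms defined by recursion on the weight -/

section

variable {P : Type x} [LeftPreLieRing P] [LeftPreLieAlgebra K P]

/-- Both trees of a pair have positive weight, so each is strictly lighter than the pair. This is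
why the recursion through `σ` is well founded. -/
theorem map_eq_map_of_mem_pairFilt {φ ψ : Br K D →ₗ[K] P} {k n : ℕ}
    (h : ∀ t : PlanarTree D, t.weight < k → φ (of K t) = ψ (of K t)) {ξ : Br K D ⊗[K] Br K D}
    (hξ : ξ ∈ pairFilt K D k n) : TensorProduct.map φ φ ξ = TensorProduct.map ψ ψ ξ := by
  suffices H : pairFilt K D k n ≤
      LinearMap.eqLocus (TensorProduct.map φ φ) (TensorProduct.map ψ ψ) from H hξ
  refine pairFilt_le fun s t hk _ => ?_
  have hs := s.weight_pos
  have ht := t.weight_pos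
  rw [LinearMap.mem_eqLocus, TensorProduct.map_tmul, TensorProduct.map_tmul, h s (by omega),
    h t (by omega)]

/-- One step of the construction of a linear map by recursion on the weight. -/
noncomputable def recStep (g : Br K D →ₗ[K] P) (σ : Br K D →ₗ[K] Br K D ⊗[K] Br K D)
    (φ : Br K D →ₗ[K] P) : Br K D →ₗ[K] P :=
  g + LinearMap.mul' K P ∘ₗ TensorProduct.map φ φ ∘ₗ σ

theorem recStep_apply (g : Br K D →ₗ[K] P) (σ : Br K D →ₗ[K] Br K D ⊗[K] Br K D)
    (φ : Br K D →ₗ[K] P) (z : Br K D) :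
    recStep g σ φ z = g z + LinearMap.mul' K P (TensorProduct.map φ φ (σ z)) := rfl

variable {g : Br K D →ₗ[K] P} {σ : Br K D →ₗ[K] Br K D ⊗[K] Br K D}

theorem recStep_congr (hσ : ∀ t : PlanarTree D, σ (of K t) ∈ pairFilt K D t.weight t.weight)
    {φ ψ : Br K D →ₗ[K] P} {t : PlanarTree D}
    (h : ∀ s : PlanarTree D, s.weight < t.weight → φ (of K s) = ψ (of K s)) :
    recStep g σ φ (of K t) = recStep g σ ψ (of K t) := by
  rw [recStep_apply, recStep_apply, map_eq_map_of_mem_pairFilt h (hσ t)]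

theorem recStep_unique (hσ : ∀ t : PlanarTree D, σ (of K t) ∈ pairFilt K D t.weight t.weight)
    {φ ψ : Br K D →ₗ[K] P} (hφ : recStep g σ φ = φ) (hψ : recStep g σ ψ = ψ) : φ = ψ := by
  suffices H : ∀ (n : ℕ) (t : PlanarTree D), t.weight < n → φ (of K t) = ψ (of K t) from
    hom_ext fun t => H _ t (Nat.lt_succ_self _)
  intro n
  induction n with
  | zero => intro t h; omega
  | succ n ih =>
    intro t h
    rw [← hφ, ← hψ]
    exact recStep_congr hσ fun s hs => ih s (by omega)

/-- On trees of weight at most `n` the iterates from the `n`-th on agree, so each tree is evaluated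
at the iterate indexed by its weight. -/
theorem exists_recStep_eq (hσ : ∀ t : PlanarTree D, σ (of K t) ∈ pairFilt K D t.weight t.weight) :
    ∃ φ : Br K D →ₗ[K] P, recStep g σ φ = φ := by
  let Φ : ℕ → Br K D →ₗ[K] P := fun n => (recStep g σ)^[n] 0
  have hΦ : ∀ n, Φ (n + 1) = recStep g σ (Φ n) := fun n => Function.iterate_succ_apply' _ _ _
  have stable : ∀ (n m : ℕ) (t : PlanarTree D), t.weight ≤ n → t.weight ≤ m →
      Φ n (of K t) = Φ m (of K t) := by
    intro n
    induction n with
    | zero => intro m t h; have := t.weight_pos; omega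
    | succ n ih =>
      intro m t hn hm
      obtain _ | m := m
      · have := t.weight_pos; omega
      · rw [hΦ, hΦ]
        exact recStep_congr hσ fun s hs => ih m s (by omega) (by omega)
  refine ⟨lin K fun t => Φ t.weight (of K t), hom_ext fun t => ?_⟩
  rw [lin_of, ← stable (t.weight + 1) t.weight t (by omega) le_rfl, hΦ]
  refine recStep_congr hσ fun s hs => ?_
  rw [lin_of, stable s.weight t.weight s le_rfl hs.le]

/-- A linear map defined by recursion on the weight, through a section of the product modulo `V`,
is a morphism of pre-Lie algebras. -/
theorem map_mulMap_of_recStep [CharZero K] {V : Submodule K (Br K D)} (hV : IsBigraded V)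
    (hc : IsCompl V (starRange K D)) {τ : Br K D →ₗ[K] V} {f : V →ₗ[K] P}
    (hτ : ∀ z, (τ z : Br K D) + mulMap (σ z) = z)
    (hσ : ∀ t : PlanarTree D, σ (of K t) ∈ pairFilt K D t.weight t.weight)
    {φ : Br K D →ₗ[K] P} (hφ : recStep (f ∘ₗ τ) σ φ = φ) :
    (∀ ξ, φ (mulMap ξ) = LinearMap.mul' K P (TensorProduct.map φ φ ξ)) ∧
      ∀ v : V, φ v = f v := by
  let μ := LinearMap.mul' K P ∘ₗ TensorProduct.map φ φ
  have hμ : ∀ y z, μ (y ⊗ₜ z) = φ y * φ z := fun _ _ => rfl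
  have hφ' : ∀ z, φ z = f (τ z) + μ (σ z) := fun z => (LinearMap.congr_fun hφ z).symm
  have hσ' : ∀ {k n z}, z ∈ filt K D k n → σ z ∈ pairFilt K D k k := by
    intro k n z hz
    suffices H : filt K D k n ≤ (pairFilt K D k k).comap σ from H hz
    exact filt_le fun t hk _ => pairFilt_mono hk hk (hσ t)
  -- Multiplicativity up to weight `k` makes `μ` kill relations of weight k + 1, because the
  -- products inside such a relation involve only two of its three trees. This in turn gives
  -- multiplicativity in weight k + 1.
  have key : ∀ k, (∀ ξ ∈ pairFilt K D k k, φ (mulMap ξ) = μ ξ) ∧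
      ∀ ρ ∈ relSpan K D k, μ ρ = 0 := by
    intro k
    induction k with
    | zero =>
      constructor
      · have : pairFilt K D 0 0 ≤ LinearMap.eqLocus (φ ∘ₗ mulMap) μ :=
          pairFilt_le fun s t _ h => absurd h (by omega)
        exact this
      · suffices H : relSpan K D 0 ≤ LinearMap.ker μ from H
        refine Submodule.span_le.2 ?_
        rintro _ ⟨r, s, t, h, rfl⟩
        have := r.weight_pos
        omega
    | succ k ih =>
      have hmul : ∀ s t : PlanarTree D, s.weight + t.weight ≤ k →
          φ (of K s * of K t) = φ (of K s) * φ (of K t) := fun s t h =>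
        ih.1 (of K s ⊗ₜ of K t)
          (of_tmul_of_mem_pairFilt h (t.rootFertility_lt_weight.trans_le (by omega)))
      have hrel : ∀ ρ ∈ relSpan K D (k + 1), μ ρ = 0 := by
        suffices H : relSpan K D (k + 1) ≤ LinearMap.ker μ from H
        refine Submodule.span_le.2 ?_
        rintro _ ⟨r, s, t, h, rfl⟩
        have h₁ := r.weight_pos
        have h₂ := s.weight_pos
        have h₃ := t.weight_pos
        rw [SetLike.mem_coe, LinearMap.mem_ker, preLieRel]
        rw [map_sub, map_sub, hμ, hμ, hμ, map_sub, hmul s t (by omega), hmul r t (by omega),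
          hmul r s (by omega), hmul s r (by omega)]
        exact mul_mul_sub_mul_mul_sub_commutator_mul _ _ _
      refine ⟨fun ξ hξ => ?_, hrel⟩
      have hσξ := hσ' (mulMap_mem hξ)
      have hdiff : mulMap (ξ - σ (mulMap ξ)) = (τ (mulMap ξ) : Br K D) := by
        rw [map_sub, sub_eq_iff_eq_add, hτ]
      -- The product of `ξ` − σ(m(ξ)) is a value of `τ`, hence in `V`; so this difference is a
      -- combination of relations, and that product is in fact 0.
      have hmem := mem_relSpan_of_mulMap_mem hV hc.disjoint (sub_mem hξ hσξ)
        (by rw [hdiff]; exact (τ (mulMap ξ)).2)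
      have hτ₀ : τ (mulMap ξ) = 0 := by
        rw [mulMap_eq_zero_of_mem_relSpan hmem] at hdiff
        exact Subtype.ext hdiff.symm
      have := hrel _ hmem
      rw [map_sub, sub_eq_zero] at this
      rw [hφ', hτ₀, map_zero, zero_add, this]
  constructor
  · refine LinearMap.congr_fun (f := φ ∘ₗ mulMap) (g := μ) ?_
    refine TensorProduct.ext (hom_ext fun s => hom_ext fun t => ?_)
    exact (key (s.weight + t.weight)).1 _ (of_tmul_of_mem_pairFilt le_rfl
      (t.rootFertility_lt_weight.trans_le (by omega)))
  · intro v
    -- On `V`, the product of σ(v) is v − τ(v) ∈ V, so σ(v) is a combination of relations and τ(v) =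
    -- v.
    obtain ⟨k, hk⟩ := exists_mem_filt (v : Br K D)
    have hdiff : mulMap (σ v) = ((v - τ v : V) : Br K D) := by
      rw [Submodule.coe_sub, eq_sub_iff_add_eq, add_comm, hτ]
    have hmem := mem_relSpan_of_mulMap_mem hV hc.disjoint (hσ' hk)
      (by rw [hdiff]; exact (v - τ v).2)
    rw [mulMap_eq_zero_of_mem_relSpan hmem] at hdiff
    have hv : v = τ v := sub_eq_zero.1 (Subtype.ext hdiff.symm)
    rw [hφ', (key k).2 _ hmem, add_zero, ← hv]

end

/-! ### Sections of the product and the universal property. -/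

theorem exists_section {V : Submodule K (Br K D)} (hV : IsBigraded V)
    (hc : Codisjoint V (starRange K D)) :
    ∃ (τ : Br K D →ₗ[K] V) (σ : Br K D →ₗ[K] Br K D ⊗[K] Br K D),
      (∀ z, (τ z : Br K D) + mulMap (σ z) = z) ∧
        ∀ t : PlanarTree D, σ (of K t) ∈ pairFilt K D t.weight t.weight := by
  have H : ∀ t : PlanarTree D, ∃ (y : V) (ξ : Br K D ⊗[K] Br K D),
      ξ ∈ pairFilt K D t.weight t.weight ∧ (y : Br K D) + mulMap ξ = of K t := by
    intro t
    obtain ⟨y, hy, z, ⟨ξ, hξ, rfl⟩, e⟩ := Submodule.mem_sup.1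
      (filt_le_sup_map_mulMap hV hc t.weight t.weight (of_mem_filt_self le_rfl))
    exact ⟨⟨y, hy⟩, ξ, hξ, e⟩
  choose y ξ hξ e using H
  refine ⟨lin K y, lin K ξ, ?_, fun t => by rw [lin_of]; exact hξ t⟩
  refine LinearMap.congr_fun (f := V.subtype ∘ₗ lin K y + mulMap ∘ₗ lin K ξ)
    (g := LinearMap.id) (hom_ext fun t => ?_)
  simpa [lin_of] using e t

theorem existsUnique_lift [CharZero K] {V : Submodule K (Br K D)} (hV : IsBigraded V)
    (hc : IsCompl V (starRange K D)) {P : Type x} [LeftPreLieRing P] [LeftPreLieAlgebra K P]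
    (f : V →ₗ[K] P) : ∃! φ : Br K D →ₙₐ[K] P, ∀ v : V, φ v = f v := by
  obtain ⟨τ, σ, hτ, hσ⟩ := exists_section hV hc.codisjoint
  obtain ⟨φ, hφ⟩ := exists_recStep_eq (g := f ∘ₗ τ) hσ
  obtain ⟨hmul, hf⟩ := map_mulMap_of_recStep hV hc hτ hσ hφ
  refine ⟨{ φ with
    map_zero' := map_zero φ
    map_mul' := fun y z => hmul (y ⊗ₜ z) }, hf, fun ψ hψ => ?_⟩
  let ψ' : Br K D →ₗ[K] P := { ψ with }
  -- Any morphism extending `f` solves the recursion: apply it to z = τ(z) + m(σ(z)).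
  have hψ' : recStep (f ∘ₗ τ) σ ψ' = ψ' := by
    have hm : ∀ ξ, LinearMap.mul' K P (TensorProduct.map ψ' ψ' ξ) = ψ' (mulMap ξ) := by
      refine LinearMap.congr_fun (f := LinearMap.mul' K P ∘ₗ TensorProduct.map ψ' ψ')
        (g := ψ' ∘ₗ mulMap) (TensorProduct.ext' fun y z => ?_)
      exact (map_mul ψ y z).symm
    ext z
    rw [recStep_apply, hm, LinearMap.comp_apply, ← hψ]
    change ψ' (τ z) + _ = _
    rw [← map_add, hτ]
  have := recStep_unique hσ hψ' hφ
  ext z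
  exact LinearMap.congr_fun this z

end Br

/-! ### Passage from linear maps on V to families indexed by a basis. -/

theorem mainTheorem1 (K : Type u) [Field K] [CharZero K] (D : Type v) [Finite D] :
    (∃ V : Submodule K (Br K D), Br.IsBigraded V ∧ IsCompl V (Br.starRange K D)) ∧
      ∀ V : Submodule K (Br K D), Br.IsBigraded V → IsCompl V (Br.starRange K D) →
        ∀ (I : Type w) (b : Module.Basis I K V),
          IsFreePreLieAlgebra.{u, w, max u v, x} K fun i => (b i : Br K D) := by
  refine ⟨Br.exists_isBigraded_isCompl_starRange K D, fun V hV hc I b P _ _ f => ?_⟩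
  obtain ⟨φ, hφ, huniq⟩ := Br.existsUnique_lift hV hc (b.constr K f)
  refine ⟨φ, fun i => by simp [hφ], fun ψ hψ => huniq ψ fun v => ?_⟩
  let ψ' : Br K D →ₗ[K] P := { ψ with }
  refine LinearMap.congr_fun (f := ψ' ∘ₗ V.subtype) (g := b.constr K f) (b.ext fun i => ?_) v
  rw [b.constr_basis]
  exact hψ i
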